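/- For integers $N,r\ge 1$ let $S_{N,r}$ be the set of $(n_1,\dots,n_r)\in\mathbb Z^r$ with all $n_i\ge 3$ odd and $n_1+\cdots+n_r=N$. Let $\mathbf V_{N,r}\subset\mathbb Q[x_1,\dots,x_r]$ be the $\mathbb Q$-span of the monomials $x_1^{n_1-1}\cdots x_r^{n_r-1}$ with $(n_1,\dots,n_r)\in S_{N,r}$, let $\mathsf{Vect}_{N,r}=\mathbb Q^{S_{N,r}}$ (row vectors), and let $\pi\colon\mathbf V_{N,r}\to\mathsf{Vect}_{N,r}$ be the isomorphism sending a polynomial to its vector of coefficients. For $r\ge2$ put $$\mathbf W_{N,r}=\{P\in\mathbf V_{N,r}\mid P(x_1,\dots,x_r)=P(x_2-x_1,x_2,x_3,\dots,x_r)-P(x_2-x_1,x_1,x_3,\dots,x_r)\}.$$ For a monomial $f=x_1^a$ and $g\in\mathbb Q[x_1,\dots,x_{r-1}]$ define $$(f\mathbin{\underline\circ}g)(x_1,\dots,x_r)=f(x_1)g(x_2,\dots,x_r)+\sum_{i=1}^{r-1}\Bigl(f(x_{i+1}-x_i)\,g(x_1,\dots,\hat x_{i+1},\dots,x_r)-(-1)^{\deg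 f}f(x_i-x_{i+1})\,g(x_1,\dots,\hat x_i,\dots,x_r)\Bigr),$$ where hats mark omitted variables, and let $e\binom{m_1,\dots,m_r}{n_1,\dots,n_r}$ be the coefficient of $x_1^{n_1-1}\cdots x_r^{n_r-1}$ in $x_1^{m_1-1}\mathbin{\underline\circ}(x_1^{m_2-1}\cdots x_{r-1}^{m_r-1})$. Define square matrices with rows $m$ and columns $n$ indexed by $S_{N,r}$: $E_{N,r}=\bigl(e\binom{m_1,\dots,m_r}{n_1,\dots,n_r}\bigr)$; for $2\le j\le r$, $$E^{(j)}_{N,r}=\Bigl(\delta_{(m_1,\dots,m_{r-j}),(n_1,\dots,n_{r-j})}\;e\tbinom{m_{r-j+1},\dots,m_r}{n_{r-j+1},\dots,n_r}\Bigr);$$ $F_{N,r}=E_{N,r}-\mathrm{id}$; and $C_{N,r}=E^{(2)}_{N,r}E^{(3)}_{N,r}\cdots E^{(r-1)}_{N,r}E_{N,r}$. Let $\ker C_{N,r}$ be the space of right annihilators of $C_{N,r}$ over $\mathbb Q$. Finally put $$\mathbb O(x)=\frac{x^3}{1-x^2},\qquad \mathbb S(x)=\frac{x^{12}}{(1-x^4)(1-x^6)}.$$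 **Theorem.** Assume that for all integers $r\ge2$ and $N>0$ the linear map $\mathbf W_{N,r}\to\mathsf{Vect}_{N,r}$, $P\mapsto\pi(P)F_{N,r}$, is injective. Then for every $N>0$ the dimension $\dim_{\mathbb Q}\ker C_{N,4}$ is at least the coefficient of $x^N$ in the power series $3\,\mathbb O(x)^2\,\mathbb S(x)-\mathbb S(x)^2$. -/

import Mathlib

namespace TotallyOdd

open MvPolynomial

/-- The set `S_{N,r}` of `r`-tuples of odd integers `≥ 3` with sum `N`. -/
def S (N r : ℕ) : Finset (Fin r → ℕ) :=
  (Finset.Nat.antidiagonalTuple r N).filter fun n => ∀ i, 3 ≤ n i ∧ Odd (n i)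

/-- The exponent vector `(n_1 - 1, …, n_r - 1)` of the monomial
`x_1^{n_1-1} ⋯ x_r^{n_r-1}` (used for `n_i ≥ 1` only). -/
noncomputable def expo {r : ℕ} (n : Fin r → ℕ) : Fin r →₀ ℕ :=
  Finsupp.equivFunOnFinite.symm fun i => n i - 1

/-- The space `V_{N,r}` of restricted totally even homogeneous polynomials of degree `N - r`. -/
noncomputable def V (N r : ℕ) : Submodule ℚ (MvPolynomial (Fin r) ℚ) :=
  Submodule.span ℚ (Set.range fun m : S N r => monomial (expo m.1) (1 : ℚ))

/-- The space `Vect_{N,r}` of (row) vectors indexed by `S_{N,r}`. -/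
abbrev Vect (N r : ℕ) : Type := S N r → ℚ

/-- The natural isomorphism `π : V_{N,r} → Vect_{N,r}`, which reads off the coefficients. -/
noncomputable def piMap (N r : ℕ) : V N r →ₗ[ℚ] Vect N r :=
  (LinearMap.pi fun n : S N r => MvPolynomial.lcoeff ℚ (expo n.1)).domRestrict (V N r)

/-- `P(x_1, …, x_r) ↦ P(x_2 - x_1, x_2, x_3, …, x_r)`. -/
noncomputable def substA {r : ℕ} (hr : 2 ≤ r) :
    MvPolynomial (Fin r) ℚ →ₐ[ℚ] MvPolynomial (Fin r) ℚ :=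
  aeval fun i : Fin r =>
    if i.val = 0 then X ⟨1, by omega⟩ - X ⟨0, by omega⟩ else X i

/-- `P(x_1, …, x_r) ↦ P(x_2 - x_1, x_1, x_3, …, x_r)`. -/
noncomputable def substB {r : ℕ} (hr : 2 ≤ r) :
    MvPolynomial (Fin r) ℚ →ₐ[ℚ] MvPolynomial (Fin r) ℚ :=
  aeval fun i : Fin r =>
    if i.val = 0 then X ⟨1, by omega⟩ - X ⟨0, by omega⟩
    else if i.val = 1 then X ⟨0, by omega⟩ else X i

/-- The subspace `W_{N,r}` of those `P ∈ V_{N,r}` with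
`P(x_1, …, x_r) = P(x_2 - x_1, x_2, x_3, …, x_r) - P(x_2 - x_1, x_1, x_3, …, x_r)`. -/
noncomputable def W (N r : ℕ) (hr : 2 ≤ r) : Submodule ℚ (V N r) where
  carrier := {P | (P : MvPolynomial (Fin r) ℚ) = substA hr P.1 - substB hr P.1}
  zero_mem' := by simp
  add_mem' := by
    intro P Q hP hQ
    simp only [Set.mem_ofPred_eq, Submodule.coe_add, map_add] at hP hQ ⊢
    linear_combination hP + hQ
  smul_mem' := by
    intro c P hP
    simp only [Set.mem_ofPred_eq, Submodule.coe_smul, map_smul] at hP ⊢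
    rw [← smul_sub, ← hP]

/-- The Ihara action `x_1^a ∘ g` of the monomial `f = x_1^a` on a polynomial `g` in `s` variables.
With `r = s + 1` it is the polynomial
`f(x_1) g(x_2, …, x_r) + ∑_{i=1}^{r-1} (f(x_{i+1} - x_i) g(x_1, …, x̂_{i+1}, …, x_r)
  - (-1)^{deg f} f(x_i - x_{i+1}) g(x_1, …, x̂_i, …, x_r))`;
here `rename p.succAbove g` is `g` evaluated at all the variables but `x_p`, in order. -/
noncomputable def ihara {s : ℕ} (a : ℕ) (g : MvPolynomial (Fin s) ℚ) :
    MvPolynomial (Fin (s + 1)) ℚ :=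
  X 0 ^ a * rename Fin.succ g +
    ∑ i : Fin s,
      ((X i.succ - X i.castSucc) ^ a * rename i.succ.succAbove g -
        (-1) ^ a * (X i.castSucc - X i.succ) ^ a * rename i.castSucc.succAbove g)

/-- `e(m_1, …, m_r; n_1, …, n_r)`, the coefficient of `x_1^{n_1-1} ⋯ x_r^{n_r-1}` in
`x_1^{m_1-1} ∘ (x_1^{m_2-1} ⋯ x_{r-1}^{m_r-1})`, for `r ≥ 1` and entries `≥ 1`.
The value at `r = 0` is a dummy. -/
noncomputable def e : {r : ℕ} → (Fin r → ℕ) → (Fin r → ℕ) → ℚ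
  | 0, _, _ => 0
  | _ + 1, m, n =>
      coeff (expo n) (ihara (m 0 - 1) (monomial (expo fun i => m i.succ) (1 : ℚ)))

/-- The matrix `E_{N,r}`. -/
noncomputable def E (N r : ℕ) : Matrix (S N r) (S N r) ℚ :=
  Matrix.of fun m n => e m.1 n.1

/-- The last `j` entries of an `r`-tuple. -/
def lastEntries {r : ℕ} (j : ℕ) (hj : j ≤ r) (m : Fin r → ℕ) : Fin j → ℕ :=
  fun k => m ⟨r - j + k, by omega⟩

/-- The matrix `E_{N,r}^{(j)}`: a Kronecker delta in the first `r - j` entries times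
`e` of the last `j` entries. -/
noncomputable def Ej (N r j : ℕ) (hj : j ≤ r) : Matrix (S N r) (S N r) ℚ :=
  Matrix.of fun m n =>
    (if ∀ i : Fin r, i.val < r - j → m.1 i = n.1 i then 1 else 0) *
      e (lastEntries j hj m.1) (lastEntries j hj n.1)

/-- The matrix `C_{N,r} = E_{N,r}^{(2)} E_{N,r}^{(3)} ⋯ E_{N,r}^{(r-1)} E_{N,r}`. -/
noncomputable def C (N r : ℕ) : Matrix (S N r) (S N r) ℚ :=
  (List.ofFn fun k : Fin (r - 2) => Ej N r (k.val + 2) (by omega)).prod * E N r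

/-- The matrix `F_{N,r} = E_{N,r} - id`. -/
noncomputable def F (N r : ℕ) : Matrix (S N r) (S N r) ℚ := E N r - 1

/-- The linear map `W_{N,r} → Vect_{N,r}`, `P ↦ π(P) F_{N,r}` (row vector times matrix). -/
noncomputable def tasakaMap (N r : ℕ) (hr : 2 ≤ r) : W N r hr →ₗ[ℚ] Vect N r :=
  (F N r).vecMulLinear ∘ₗ piMap N r ∘ₗ (W N r hr).subtype

/-- `O(x) = x^3 / (1 - x^2)`. -/
noncomputable def oddSeries : PowerSeries ℚ :=
  PowerSeries.X ^ 3 * (1 - PowerSeries.X ^ 2)⁻¹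

/-- `S(x) = x^12 / ((1 - x^4) (1 - x^6))`. -/
noncomputable def cuspSeries : PowerSeries ℚ :=
  PowerSeries.X ^ 12 * ((1 - PowerSeries.X ^ 4) * (1 - PowerSeries.X ^ 6))⁻¹

end TotallyOdd

/-!
A polynomial `P` in `W` is antisymmetric in its first two variables. Together with the relation
defining `W` this makes the sums in the Ihara action cancel, so that `P * E + P * E^(r-1) = P` and
`P * E^(r-1) * E = 0`. Hence on `W` the matrix `F = E - 1` agrees with `-E^(r-1)` and its image is
killed by `E`. If `F` is injective on `W`, then lifting the image of
`W ⊓ range (E^(2) ⋯ E^(r-2))` along `E^(2) ⋯ E^(r-1)` produces vectors in the left kernel of `C`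
beyond the kernel of `E^(2) ⋯ E^(r-1)`. Outer products of a vector of depth one with `ker C` in
depth `r - 1`, respectively of `W` in depth two with `range C` in depth `r - 2`, bound the two
contributions from below. This is a recursion
`K_r ≥ O * K_{r-1} + W_2 * (rank series of C in depth r - 2)` between generating series. It is
solved up to `r = 4` starting from `K_2 ≥ W_2 ≥ S`, where the last inequality is the lower bound for
the space of even period polynomials: a polynomial of degree at most `w` that is antisymmetric under
the anharmonic group is determined by its first `w / 6` odd coefficients.
-/

namespace TotallyOdd

open Finset.HasAntidiagonal (antidiagonal)

/-! ### Polynomials antisymmetric under the anharmonic group -/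

section Dihedral

open Polynomial

theorem eval_reflect {K : Type*} [Field K] {q : K[X]} {w : ℕ} (hq : q.natDegree ≤ w) {x : K}
    (hx : x ≠ 0) : (q.reflect w).eval x = x ^ w * q.eval x⁻¹ := by
  let _ := invertibleOfNonzero (inv_ne_zero hx)
  have h := eval₂_reflect_mul_pow (RingHom.id K) x⁻¹ w q hq
  simp only [invOf_eq_inv, inv_inv, eval₂_id] at h
  rw [← h, mul_left_comm, ← mul_pow, mul_inv_cancel₀ hx, one_pow, mul_one]

theorem reflect_eq_neg_iff {K : Type*} [Field K] [Infinite K] {q : K[X]} {w : ℕ}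
    (hq : q.natDegree ≤ w) :
    q.reflect w = -q ↔ ∀ x : K, x ≠ 0 → x ^ w * q.eval x⁻¹ = -q.eval x := by
  refine ⟨fun h x hx => by rw [← eval_reflect hq hx, h, eval_neg], fun h => ?_⟩
  refine eq_of_infinite_eval_eq _ _ ((Set.finite_singleton (0 : K)).infinite_compl.mono ?_)
  intro x hx
  rw [Set.mem_ofPred_eq, eval_reflect hq hx, eval_neg, h x hx]

theorem coeff_comp_one_sub_X {R : Type*} [CommRing R] [IsDomain R] {q : R[X]} {d : ℕ}
    (hq : q.natDegree ≤ d) : (q.comp (1 - X)).coeff d = q.coeff d * (-1) ^ d := by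
  have hX : (1 - X : R[X]) = -(X - Polynomial.C 1) := by simp
  have hdeg : (1 - X : R[X]).natDegree = 1 := by rw [hX, natDegree_neg, natDegree_X_sub_C]
  rcases hq.lt_or_eq with h | rfl
  · rw [coeff_eq_zero_of_natDegree_lt h, zero_mul, coeff_eq_zero_of_natDegree_lt]
    rwa [natDegree_comp, hdeg, mul_one]
  · have h := coeff_comp_degree_mul_degree (p := q) (q := 1 - X) (by rw [hdeg]; exact one_ne_zero)
    rwa [hdeg, hX, leadingCoeff_neg, leadingCoeff_X_sub_C, mul_one, ← hX] at h

theorem natDegree_le_of_reflect_eq_neg {R : Type*} [Ring R] {q : R[X]} {w k : ℕ}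
    (hq : q.natDegree ≤ w) (hreflect : q.reflect w = -q) (hk : ∀ j < k, q.coeff j = 0) :
    q.natDegree ≤ w - k := by
  rw [natDegree_le_iff_coeff_eq_zero]
  intro j hj
  rcases le_or_gt j w with hjw | hjw
  · have h := congrArg (fun p => p.coeff j) hreflect
    simp only [coeff_reflect, revAt_le hjw, coeff_neg] at h
    rw [← neg_eq_zero, ← h, hk _ (by omega)]
  · exact coeff_eq_zero_of_natDegree_lt (hq.trans_lt hjw)

theorem sum_rootMultiplicity_le_natDegree {R : Type*} [CommRing R] [IsDomain R] (q : R[X])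
    (s : Finset R) : ∑ a ∈ s, q.rootMultiplicity a ≤ q.natDegree := by
  classical
  calc ∑ a ∈ s, q.rootMultiplicity a
      = ∑ a ∈ s, (q.roots.filter (· ∈ s)).count a := Finset.sum_congr rfl fun a ha => by
        rw [Multiset.count_filter_of_pos ha, count_roots]
    _ = (q.roots.filter (· ∈ s)).card :=
        Multiset.sum_count_eq_card fun a ha => (Multiset.mem_filter.1 ha).2
    _ ≤ q.natDegree := (Multiset.card_le_card (Multiset.filter_le _ _)).trans q.card_roots'

variable {K : Type*} [Field K] [CharZero K] {q : K[X]} {w : ℕ}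

theorem coeff_eq_zero_of_dihedral (hw : Even w) (hq : q.natDegree ≤ w)
    (hcomp : q.comp (1 - X) = -q) (hreflect : q.reflect w = -q) {n : ℕ} (hn : 2 * n ≤ w)
    (hodd : ∀ k < n, q.coeff (2 * k + 1) = 0) {k : ℕ} (hk : k < 2 * n + 1) : q.coeff k = 0 := by
  induction k using Nat.strong_induction_on with
  | _ k ih =>
  rcases Nat.even_or_odd k with heven | ⟨l, rfl⟩
  · have hkw : k ≤ w := by omega
    have hdeg := natDegree_le_of_reflect_eq_neg hq hreflect fun j hj => ih j hj (hj.trans hk)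
    have htop := coeff_comp_one_sub_X hdeg
    have hrev := congrArg (fun p => p.coeff k) hreflect
    simp only [coeff_reflect, revAt_le hkw, coeff_neg] at hrev
    have hsub : Even (w - k) := (Nat.even_sub hkw).2 (iff_of_true hw heven)
    rw [hcomp, coeff_neg, hsub.neg_one_pow, mul_one] at htop
    rw [← neg_eq_zero, ← hrev, self_eq_neg.1 htop.symm]
  · exact hodd l (by omega)

theorem eval_eq_zero_of_dihedral (hw : Even w) (hq : q.natDegree ≤ w)
    (hcomp : q.comp (1 - X) = -q) (hreflect : q.reflect w = -q) :
    q.eval (-1) = 0 ∧ q.eval 2 = 0 ∧ q.eval 2⁻¹ = 0 := by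
  have hsymm (x : K) : q.eval (1 - x) = -q.eval x := by
    simpa [eval_comp] using congrArg (eval x) hcomp
  have hneg : q.eval (-1) = 0 := by
    have h := (reflect_eq_neg_iff hq).1 hreflect (-1) (neg_ne_zero.2 one_ne_zero)
    rwa [hw.neg_one_pow, inv_neg, inv_one, one_mul, self_eq_neg] at h
  refine ⟨hneg, ?_, ?_⟩
  · have h := hsymm (-1)
    rwa [hneg, neg_zero, sub_neg_eq_add, one_add_one_eq_two] at h
  · have h := hsymm 2⁻¹
    rwa [show (1 : K) - 2⁻¹ = 2⁻¹ by norm_num, self_eq_neg] at h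

/-- The orders of vanishing at `0`, `1` and `∞` are at least `2 * (w / 6) + 1`, and the fixed points
`-1`, `2`, `1 / 2` of the three reflections are zeros: too many for degree `w`. -/
theorem eq_zero_of_dihedral (hw : Even w) (hq : q.natDegree ≤ w)
    (hcomp : q.comp (1 - X) = -q) (hreflect : q.reflect w = -q)
    (hodd : ∀ k < w / 6, q.coeff (2 * k + 1) = 0) : q = 0 := by
  classical
  by_contra hne
  have hcoeff : ∀ k < 2 * (w / 6) + 1, q.coeff k = 0 := fun k hk =>
    coeff_eq_zero_of_dihedral hw hq hcomp hreflect (by omega) hodd hk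
  have hdeg := natDegree_le_of_reflect_eq_neg hq hreflect hcoeff
  have hmult_zero : 2 * (w / 6) + 1 ≤ q.rootMultiplicity 0 := by
    rw [le_rootMultiplicity_iff hne, map_zero, sub_zero]
    exact X_pow_dvd_iff.2 hcoeff
  have hmult_one : 2 * (w / 6) + 1 ≤ q.rootMultiplicity 1 := by
    obtain ⟨g, rfl⟩ := X_pow_dvd_iff.2 hcoeff
    rw [le_rootMultiplicity_iff hne, ← dvd_neg, ← hcomp, mul_comp, pow_comp, X_comp, map_one]
    exact (pow_dvd_pow_of_dvd (neg_dvd.1 (neg_sub (X : K[X]) 1).dvd) _).mul_right _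
  obtain ⟨hneg_one, htwo, hhalf⟩ := eval_eq_zero_of_dihedral hw hq hcomp hreflect
  have hpos (a : K) (ha : q.eval a = 0) : 0 < q.rootMultiplicity a :=
    (rootMultiplicity_pos hne).2 ha
  have hsum := sum_rootMultiplicity_le_natDegree q {0, 1, -1, 2, 2⁻¹}
  rw [Finset.sum_insert (by norm_num), Finset.sum_insert (by norm_num),
    Finset.sum_insert (by norm_num), Finset.sum_pair (by norm_num)] at hsum
  have := hpos _ hneg_one
  have := hpos _ htwo
  have := hpos _ hhalf
  omega

end Dihedral

/-! ### Coefficient vectors -/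

section Vect

open MvPolynomial

variable {N r : ℕ}

theorem mem_S {n : Fin r → ℕ} : n ∈ S N r ↔ ∑ i, n i = N ∧ ∀ i, 3 ≤ n i ∧ Odd (n i) := by
  simp only [S, Finset.mem_filter, Finset.Nat.mem_antidiagonalTuple]

theorem expo_apply (n : Fin r → ℕ) (i : Fin r) : expo n i = n i - 1 := rfl

theorem expo_injective : Function.Injective fun n : S N r => expo n.1 := by
  intro m n h
  ext i
  have hi : m.1 i - 1 = n.1 i - 1 := DFunLike.congr_fun h i
  have := ((mem_S.1 m.2).2 i).1
  have := ((mem_S.1 n.2).2 i).1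
  omega

theorem even_expo (n : S N r) (i : Fin r) : Even (expo n.1 i) :=
  ((mem_S.1 n.2).2 i).2.tsub_odd odd_one

theorem exists_expo_eq_iff {d : Fin r →₀ ℕ} :
    (∃ n : S N r, expo n.1 = d) ↔ (∀ i, Even (d i) ∧ d i ≠ 0) ∧ d.degree + r = N := by
  have hsum (n : Fin r → ℕ) (hn : ∀ i, 1 ≤ n i) : (expo n).degree + r = ∑ i, n i := by
    calc (expo n).degree + r
        = ∑ i, (expo n i + 1) := by
          rw [Finsupp.degree_eq_sum, Finset.sum_add_distrib, Fin.sum_const, smul_eq_mul, mul_one]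
      _ = ∑ i, n i := Finset.sum_congr rfl fun i _ => Nat.sub_add_cancel (hn i)
  constructor
  · rintro ⟨n, rfl⟩
    obtain ⟨hN, hn⟩ := mem_S.1 n.2
    refine ⟨fun i => ⟨even_expo n i, ?_⟩, (hsum n.1 fun i => ?_).trans hN⟩
    · have := (hn i).1
      rw [expo_apply]
      omega
    · exact (Nat.le_add_left 1 2).trans (hn i).1
  · rintro ⟨hd, hN⟩
    have hexpo : expo (fun i => d i + 1) = d := Finsupp.ext fun i => Nat.add_sub_cancel _ _
    refine ⟨⟨fun i => d i + 1, mem_S.2 ⟨?_, fun i => ⟨?_, (hd i).1.add_one⟩⟩⟩, hexpo⟩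
    · rw [← hsum _ fun i => Nat.le_add_left 1 _, hexpo, hN]
    · obtain ⟨⟨k, hk⟩, hne⟩ := hd i
      omega

/-- The polynomial in `V N r` with a given vector of coefficients; the inverse of `piMap`. -/
noncomputable def toPoly (N r : ℕ) : Vect N r →ₗ[ℚ] MvPolynomial (Fin r) ℚ :=
  Fintype.linearCombination ℚ fun m : S N r => monomial (expo m.1) (1 : ℚ)

theorem toPoly_apply (v : Vect N r) :
    toPoly N r v = ∑ m : S N r, v m • monomial (expo m.1) (1 : ℚ) :=
  Fintype.linearCombination_apply _ _ _

theorem toPoly_mem_V (v : Vect N r) : toPoly N r v ∈ V N r := by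
  rw [toPoly_apply]
  exact Submodule.sum_mem _ fun m _ => Submodule.smul_mem _ _ (Submodule.subset_span ⟨m, rfl⟩)

theorem coeff_toPoly (v : Vect N r) (n : S N r) : coeff (expo n.1) (toPoly N r v) = v n := by
  rw [toPoly_apply, coeff_sum, Finset.sum_eq_single n]
  · rw [coeff_smul, coeff_monomial, if_pos rfl, smul_eq_mul, mul_one]
  · intro m _ hm
    rw [coeff_smul, coeff_monomial, if_neg (expo_injective.ne hm), smul_zero]
  · exact fun h => absurd (Finset.mem_univ n) h

theorem exists_expo_eq_of_mem_support {v : Vect N r} {d : Fin r →₀ ℕ}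
    (hd : d ∈ (toPoly N r v).support) : ∃ n : S N r, expo n.1 = d := by
  contrapose! hd
  rw [notMem_support_iff, toPoly_apply, coeff_sum]
  exact Finset.sum_eq_zero fun m _ => by rw [coeff_smul, coeff_monomial, if_neg (hd m), smul_zero]

/-- The space of coefficient vectors of the elements of `W`. -/
noncomputable def vecW (N r : ℕ) (hr : 2 ≤ r) : Submodule ℚ (Vect N r) :=
  LinearMap.eqLocus (toPoly N r) (((substA hr).toLinearMap - (substB hr).toLinearMap) ∘ₗ toPoly N r)

theorem mem_vecW {hr : 2 ≤ r} {v : Vect N r} :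
    v ∈ vecW N r hr ↔ toPoly N r v = substA hr (toPoly N r v) - substB hr (toPoly N r v) :=
  Iff.rfl

theorem eq_zero_of_vecMul_F {hr : 2 ≤ r} (hinj : Function.Injective (tasakaMap N r hr))
    {v : Vect N r} (hv : v ∈ vecW N r hr) (h : Matrix.vecMul v (F N r) = 0) : v = 0 := by
  let P : W N r hr := ⟨⟨toPoly N r v, toPoly_mem_V v⟩, mem_vecW.1 hv⟩
  have hP : piMap N r P.1 = v := funext fun n => coeff_toPoly v n
  have hmap : tasakaMap N r hr P = 0 := by
    change Matrix.vecMul (piMap N r P.1) (F N r) = 0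
    rw [hP, h]
  rw [← hP, hinj (hmap.trans (map_zero _).symm), Submodule.coe_zero, map_zero]

end Vect

/-! ### Even restricted period polynomials -/

section Period

open MvPolynomial

variable {N : ℕ} {R : Type*} [CommRing R] [Algebra ℚ R]

/-- The value at `(x, y)` of the binary form with a given vector of coefficients. -/
noncomputable def binaryForm (N : ℕ) (x y : R) : Vect N 2 →ₗ[ℚ] R :=
  (aeval ![x, y]).toLinearMap ∘ₗ toPoly N 2

theorem binaryForm_apply (x y : R) (v : Vect N 2) :
    binaryForm N x y v = ∑ n : S N 2, v n • (x ^ (n.1 0 - 1) * y ^ (n.1 1 - 1)) := by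
  simp only [binaryForm, LinearMap.comp_apply, AlgHom.toLinearMap_apply, toPoly_apply, map_sum,
    map_smul, aeval_monomial, map_one, one_mul, Finsupp.prod_pow, Fin.prod_univ_two, expo_apply,
    Matrix.cons_val_zero, Matrix.cons_val_one]

theorem map_binaryForm {R' : Type*} [CommRing R'] [Algebra ℚ R'] (φ : R →ₐ[ℚ] R') (x y : R)
    (v : Vect N 2) : φ (binaryForm N x y v) = binaryForm N (φ x) (φ y) v := by
  simp only [binaryForm_apply, map_sum, map_smul, map_mul, map_pow]

theorem aeval_toPoly_two (x : Fin 2 → R) (v : Vect N 2) :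
    aeval x (toPoly N 2 v) = binaryForm N (x 0) (x 1) v := by
  rw [binaryForm, LinearMap.comp_apply, AlgHom.toLinearMap_apply, ← FinVec.etaExpand_eq x]
  rfl

theorem entries_add_entries (n : S N 2) : n.1 0 + n.1 1 = N := by
  rw [← Fin.sum_univ_two, (mem_S.1 n.2).1]

theorem three_le_entry {r : ℕ} (n : S N r) (i : Fin r) : 3 ≤ n.1 i := ((mem_S.1 n.2).2 i).1

theorem binaryForm_neg_left (x y : R) : binaryForm N (-x) y = binaryForm N x y := by
  refine LinearMap.ext fun v => ?_
  rw [binaryForm_apply, binaryForm_apply]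
  exact Finset.sum_congr rfl fun n _ => by rw [← expo_apply, (even_expo n 0).neg_pow]

theorem binaryForm_mul (t x y : R) (v : Vect N 2) :
    binaryForm N (t * x) (t * y) v = t ^ (N - 2) * binaryForm N x y v := by
  rw [binaryForm_apply, binaryForm_apply, Finset.mul_sum]
  refine Finset.sum_congr rfl fun n _ => ?_
  have := three_le_entry n 0
  have := three_le_entry n 1
  have hdeg : N - 2 = (n.1 0 - 1) + (n.1 1 - 1) := by
    have := entries_add_entries n
    omega
  rw [hdeg, mul_smul_comm, mul_pow, mul_pow, pow_add, mul_mul_mul_comm]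

theorem natDegree_binaryForm_le {x y : Polynomial ℚ} (hx : x.natDegree ≤ 1) (hy : y.natDegree ≤ 1)
    (v : Vect N 2) : (binaryForm N x y v).natDegree ≤ N - 2 := by
  rw [binaryForm_apply]
  refine Polynomial.natDegree_sum_le_of_forall_le _ _ fun n _ => ?_
  refine (Polynomial.natDegree_smul_le _ _).trans ((Polynomial.natDegree_mul_le_of_le
    (Polynomial.natDegree_pow_le_of_le _ hx) (Polynomial.natDegree_pow_le_of_le _ hy)).trans ?_)
  have := entries_add_entries n
  have := three_le_entry n 0
  have := three_le_entry n 1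
  omega

/-- The tuple with the same entries in the opposite order. -/
def revEntries {r : ℕ} (n : S N r) : S N r :=
  ⟨n.1 ∘ Fin.rev, by
    obtain ⟨hsum, hodd⟩ := mem_S.1 n.2
    exact mem_S.2 ⟨(Equiv.sum_comp Fin.revPerm n.1).trans hsum, fun i => hodd i.rev⟩⟩

theorem revEntries_involutive {r : ℕ} : Function.Involutive (revEntries (N := N) (r := r)) :=
  fun n => Subtype.ext (funext fun i => congrArg n.1 i.rev_rev)

/-- The coefficient vectors of the antisymmetric binary forms. -/
def antisymm (N : ℕ) : Submodule ℚ (Vect N 2) :=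
  LinearMap.eqLocus (LinearMap.funLeft ℚ ℚ revEntries) (-LinearMap.id)

theorem mem_antisymm {v : Vect N 2} : v ∈ antisymm N ↔ ∀ n, v (revEntries n) = -v n :=
  funext_iff

theorem binaryForm_swap {v : Vect N 2} (hv : v ∈ antisymm N) (x y : R) :
    binaryForm N y x v = -binaryForm N x y v := by
  rw [binaryForm_apply, binaryForm_apply, ← Equiv.sum_comp revEntries_involutive.toPerm,
    ← Finset.sum_neg_distrib]
  refine Finset.sum_congr rfl fun n _ => ?_
  rw [Function.Involutive.coe_toPerm, mem_antisymm.1 hv, neg_smul, mul_comm]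
  rfl

theorem card_le_finrank_antisymm {ι : Type*} [Fintype ι] {n : ι → S N 2}
    (hn : Function.Injective n) (hrev : ∀ i j, n i ≠ revEntries (n j)) :
    Fintype.card ι ≤ Module.finrank ℚ (antisymm N) := by
  let f : (ι → ℚ) →ₗ[ℚ] Vect N 2 :=
    (LinearMap.id - LinearMap.funLeft ℚ ℚ revEntries) ∘ₗ Function.ExtendByZero.linearMap ℚ n
  have hmem (c : ι → ℚ) : f c ∈ antisymm N := mem_antisymm.2 fun m => by
    change _ - Function.extend n c 0 (revEntries (revEntries m)) = -(_ - _)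
    rw [revEntries_involutive, neg_sub]
    rfl
  have hinj : Function.Injective f := by
    refine (injective_iff_map_eq_zero f).2 fun c hc => funext fun j => ?_
    have h : Function.extend n c 0 (n j) - Function.extend n c 0 (revEntries (n j)) = 0 :=
      congrFun hc (n j)
    rwa [hn.extend_apply, Function.extend_apply' _ _ _ fun ⟨i, hi⟩ => hrev i j hi, Pi.zero_apply,
      sub_zero] at h
  have h := LinearMap.finrank_le_finrank_of_injective (f := f.codRestrict (antisymm N) hmem)
    fun c d hcd => hinj (congrArg Subtype.val hcd)
  rwa [Module.finrank_fintype_fun_eq_card] at h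

theorem le_finrank_antisymm (hN : Even N) :
    (N / 2 - 2) / 2 ≤ Module.finrank ℚ (antisymm N) := by
  obtain ⟨M, hM⟩ := hN
  let n (i : Fin ((N / 2 - 2) / 2)) : S N 2 := ⟨![2 * i + 3, N - (2 * i + 3)], by
    simp only [mem_S, Fin.sum_univ_two, Fin.forall_fin_two, Matrix.cons_val_zero,
      Matrix.cons_val_one]
    exact ⟨by omega, ⟨by omega, ⟨i + 1, by ring⟩⟩, by omega, ⟨M - i - 2, by omega⟩⟩⟩
  have hn : Function.Injective n := fun i j h => by
    have : 2 * i.1 + 3 = 2 * j.1 + 3 := congrFun (congrArg Subtype.val h) 0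
    omega
  have hrev (i j) : n i ≠ revEntries (n j) := fun h => by
    have : 2 * i.1 + 3 = N - (2 * j + 3) := congrFun (congrArg Subtype.val h) 0
    omega
  simpa only [Fintype.card_fin] using card_le_finrank_antisymm hn hrev

/-- The three-term relation of even period polynomials for a binary form `f`, dehomogenized:
`f (x, 1) - f (1 - x, 1) + f (1 - x, x)`. -/
noncomputable def periodDefect (N : ℕ) : Vect N 2 →ₗ[ℚ] Polynomial ℚ :=
  binaryForm N Polynomial.X 1 - binaryForm N (1 - Polynomial.X) 1 +
    binaryForm N (1 - Polynomial.X) Polynomial.X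

theorem eval_periodDefect (v : Vect N 2) (x : ℚ) : (periodDefect N v).eval x =
    binaryForm N x 1 v - binaryForm N (1 - x) 1 v + binaryForm N (1 - x) x v := by
  have h (f g : Polynomial ℚ) :
      (binaryForm N f g v).eval x = binaryForm N (f.eval x) (g.eval x) v :=
    map_binaryForm (Polynomial.aeval x) f g v
  simp only [periodDefect, LinearMap.add_apply, LinearMap.sub_apply, Polynomial.eval_add,
    Polynomial.eval_sub, h, Polynomial.eval_X, Polynomial.eval_one]

theorem natDegree_periodDefect_le (v : Vect N 2) : (periodDefect N v).natDegree ≤ N - 2 := by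
  have hX : (1 - Polynomial.X : Polynomial ℚ).natDegree ≤ 1 := by compute_degree
  exact Polynomial.natDegree_add_le_of_degree_le
    (Polynomial.natDegree_sub_le_of_le (m := N - 2)
      (natDegree_binaryForm_le Polynomial.natDegree_X_le (by simp) v)
      (natDegree_binaryForm_le hX (by simp) v) |>.trans (max_self _).le)
    (natDegree_binaryForm_le hX Polynomial.natDegree_X_le v)

theorem periodDefect_comp {v : Vect N 2} (hv : v ∈ antisymm N) :
    (periodDefect N v).comp (1 - Polynomial.X) = -periodDefect N v := by
  refine Polynomial.funext fun x => ?_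
  rw [Polynomial.eval_comp, Polynomial.eval_neg, eval_periodDefect, eval_periodDefect,
    Polynomial.eval_sub, Polynomial.eval_one, Polynomial.eval_X, sub_sub_cancel,
    binaryForm_swap hv (1 - x) x]
  ring

theorem reflect_periodDefect {v : Vect N 2} (hv : v ∈ antisymm N) :
    (periodDefect N v).reflect (N - 2) = -periodDefect N v := by
  refine (reflect_eq_neg_iff (natDegree_periodDefect_le v)).2 fun x hx => ?_
  rw [eval_periodDefect, eval_periodDefect, mul_add, mul_sub, ← binaryForm_mul, ← binaryForm_mul,
    ← binaryForm_mul, mul_one, mul_sub, mul_inv_cancel₀ hx, mul_one, ← neg_sub 1 x,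
    binaryForm_neg_left, binaryForm_neg_left, binaryForm_swap hv x 1]
  ring

theorem mem_vecW_of_periodDefect {v : Vect N 2} (h : periodDefect N v = 0) :
    v ∈ vecW N 2 le_rfl := by
  rw [mem_vecW]
  refine MvPolynomial.funext_set (fun _ => {0}ᶜ)
    (fun _ => (Set.finite_singleton (0 : ℚ)).infinite_compl) fun z hz => ?_
  have hz : z 1 ≠ 0 := hz 1 trivial
  have hdefect := congrArg (z 1 ^ (N - 2) * ·) (eval_periodDefect v (z 0 / z 1))
  simp only [h, Polynomial.eval_zero, mul_zero, mul_add, mul_sub, ← binaryForm_mul, mul_one,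
    mul_div_cancel₀ _ hz] at hdefect
  rw [← coe_aeval_eq_eval, RingHom.coe_coe, map_sub, substA, substB, ← AlgHom.comp_apply,
    ← AlgHom.comp_apply, comp_aeval, comp_aeval, aeval_toPoly_two, aeval_toPoly_two,
    aeval_toPoly_two]
  simp only [Fin.isValue, Fin.coe_ofNat_eq_mod, Nat.zero_mod, Nat.mod_succ, one_ne_zero, ↓reduceIte,
    Fin.mk_one, Fin.zero_eta, map_sub, aeval_X]
  linarith

theorem le_finrank_vecW (hN : Even N) :
    (N / 2 - 2) / 2 - (N - 2) / 6 ≤ Module.finrank ℚ (vecW N 2 le_rfl) := by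
  let Φ : antisymm N →ₗ[ℚ] (Fin ((N - 2) / 6) → ℚ) := LinearMap.pi fun k =>
    Polynomial.lcoeff ℚ (2 * k.1 + 1) ∘ₗ (periodDefect N).domRestrict (antisymm N)
  have hker : (LinearMap.ker Φ).map (antisymm N).subtype ≤ vecW N 2 le_rfl := by
    rintro _ ⟨⟨v, hv⟩, hΦ, rfl⟩
    exact mem_vecW_of_periodDefect (eq_zero_of_dihedral (hN.tsub even_two)
      (natDegree_periodDefect_le v) (periodDefect_comp hv) (reflect_periodDefect hv)
      fun k hk => congrFun hΦ ⟨k, hk⟩)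
  have hle := Submodule.finrank_mono hker
  rw [Submodule.finrank_map_subtype_eq] at hle
  have hrange := Submodule.finrank_le (LinearMap.range Φ)
  rw [Module.finrank_fin_fun] at hrange
  have := Φ.finrank_range_add_finrank_ker
  have := le_finrank_antisymm hN
  omega

end Period

/-! ### The Ihara action -/

section IharaSum

theorem removeNth_succ_cons {X : Type*} {n : ℕ} (p : Fin (n + 1)) (x : X) (y : Fin (n + 1) → X) :
    p.succ.removeNth (Fin.cons x y : Fin (n + 2) → X) = Fin.cons x (p.removeNth y) := by
  funext k
  cases k using Fin.cases <;>
    simp only [Fin.removeNth_apply, Fin.succ_succAbove_zero, Fin.succ_succAbove_succ,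
      Fin.cons_zero, Fin.cons_succ]

variable {A M : Type*} [AddCommGroup A] [AddCommGroup M] {n : ℕ}

/-- The sum over consecutive entries `z_i`, `z_{i+1}` in the Ihara action, for a function `g` of the
difference `z_{i+1} - z_i` and of the tuple `z` without `z_{i+1}`, respectively without `z_i`. -/
def iharaSum (g : A → (Fin n → A) → M) (z : Fin (n + 1) → A) : M :=
  ∑ i : Fin n, (g (z i.succ - z i.castSucc) (i.succ.removeNth z) -
    g (z i.succ - z i.castSucc) (i.castSucc.removeNth z))

theorem iharaSum_cons (g : A → (Fin (n + 1) → A) → M) (x : A) (y : Fin (n + 1) → A) :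
    iharaSum g (Fin.cons x y) = g (y 0 - x) (Fin.cons x (Fin.tail y)) - g (y 0 - x) y +
      iharaSum (fun u t => g u (Fin.cons x t)) y := by
  simp only [iharaSum, Fin.sum_univ_succ, Fin.castSucc_zero, ← Fin.succ_castSucc,
    removeNth_succ_cons, Fin.removeNth_zero, Fin.tail_cons, Fin.cons_zero, Fin.cons_succ]

theorem iharaSum_add (g g' : A → (Fin n → A) → M) (z : Fin (n + 1) → A) :
    iharaSum (fun u t => g u t + g' u t) z = iharaSum g z + iharaSum g' z := by
  simp only [iharaSum, add_sub_add_comm, Finset.sum_add_distrib]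

theorem iharaSum_sub (g g' : A → (Fin n → A) → M) (z : Fin (n + 1) → A) :
    iharaSum (fun u t => g u t - g' u t) z = iharaSum g z - iharaSum g' z := by
  simp only [iharaSum, sub_sub_sub_comm, Finset.sum_sub_distrib]

theorem iharaSum_neg (g : A → (Fin n → A) → M) (z : Fin (n + 1) → A) :
    iharaSum (fun u t => -g u t) z = -iharaSum g z := by
  simp only [iharaSum, neg_sub_neg, ← Finset.sum_neg_distrib, neg_sub]

theorem map_iharaSum {A' M' F : Type*} [AddCommGroup A'] [AddCommGroup M'] [FunLike F M M']
    [AddMonoidHomClass F M M'] (φ : F) (f : A → A') {g : A → (Fin n → A) → M}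
    {g' : A' → (Fin n → A') → M'} (hf : ∀ x y, f (x - y) = f x - f y)
    (hg : ∀ u t, φ (g u t) = g' (f u) (f ∘ t)) (z : Fin (n + 1) → A) :
    φ (iharaSum g z) = iharaSum g' (f ∘ z) := by
  simp only [iharaSum, map_sum, map_sub, hg, hf]
  rfl

/-- Terms in which the two pairs of consecutive entries are disjoint cancel by antisymmetry, and the
terms for two adjacent pairs cancel by the three-term relation. -/
theorem iharaSum_iharaSum_eq_zero (f : A → A → (Fin n → A) → M)
    (hanti : ∀ u v t, f u v t = -f v u t)
    (hrel : ∀ u v t, f u v t = f (v - u) v t - f (v - u) u t) (z : Fin (n + 2) → A) :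
    iharaSum (fun u => iharaSum (f u)) z = 0 := by
  induction n with
  | zero => simp only [iharaSum, Finset.univ_eq_empty, Finset.sum_empty, sub_self,
      Finset.sum_const_zero]
  | succ n ih =>
    obtain ⟨x, y, rfl⟩ : ∃ x y, z = Fin.cons x y := ⟨_, _, (Fin.cons_self_tail z).symm⟩
    simp only [iharaSum_cons, iharaSum_add, ih (fun u v t => f u v (Fin.cons x t))
      (fun _ _ _ => hanti _ _ _) fun _ _ _ => hrel _ _ _]
    obtain ⟨x', w, rfl⟩ : ∃ x' w, y = Fin.cons x' w := ⟨_, _, (Fin.cons_self_tail y).symm⟩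
    have hdisjoint (c : A) : iharaSum (fun u t => f u (x' - x) (Fin.cons c t)) w =
        -iharaSum (fun v t => f (x' - x) v (Fin.cons c t)) w := by
      rw [← iharaSum_neg]
      simp only [← hanti]
    have hadjacent (t) : f (x' - x) (w 0 - x) t =
        f (w 0 - x') (w 0 - x) t - f (w 0 - x') (x' - x) t := by
      rw [hrel, sub_sub_sub_cancel_right]
    simp only [iharaSum_cons, Fin.cons_zero, Fin.tail_cons, iharaSum_sub, hdisjoint, hadjacent]
    simp only [hanti (x' - x) (w 0 - x')]
    abel

theorem antisymm_of_relation {X : Type*} {f : A → A → X → M} (heven : ∀ u v t, f (-u) v t = f u v t)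
    (hrel : ∀ u v t, f u v t = f (v - u) v t - f (v - u) u t) (u v : A) (t : X) :
    f u v t = -f v u t := by
  rw [hrel u, hrel v, ← neg_sub v u, heven, heven, neg_sub]

end IharaSum

section Operators

open MvPolynomial

/-- The linear extension of the Ihara action `f ⊗ g ↦ f ∘ g`, on polynomials of which the first
variable is that of `f`; for even powers `f` the two signs in the definition agree. -/
noncomputable def iharaOp (s : ℕ) :
    MvPolynomial (Fin (s + 1)) ℚ →ₗ[ℚ] MvPolynomial (Fin (s + 1)) ℚ where
  toFun P := P + iharaSum (fun u y => aeval (Fin.cons u y) P) X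
  map_add' P Q := by simp only [map_add, iharaSum_add, add_add_add_comm]
  map_smul' c P := by
    simp only [map_smul, RingHom.id_apply, smul_add, iharaSum, ← smul_sub, Finset.smul_sum]

/-- The operator `iharaOp s` on the last `s + 1` of `s + 2` variables. -/
noncomputable def tailIharaOp (s : ℕ) :
    MvPolynomial (Fin (s + 2)) ℚ →ₗ[ℚ] MvPolynomial (Fin (s + 2)) ℚ where
  toFun P := P + iharaSum (fun u y => aeval (Fin.cons (X 0) (Fin.cons u y)) P) (Fin.tail X)
  map_add' P Q := by simp only [map_add, iharaSum_add, add_add_add_comm]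
  map_smul' c P := by
    simp only [map_smul, RingHom.id_apply, smul_add, iharaSum, ← smul_sub, Finset.smul_sum]

variable {s N : ℕ} {A : Type*} [CommRing A] [Algebra ℚ A]

theorem iharaOp_apply (P : MvPolynomial (Fin (s + 1)) ℚ) :
    iharaOp s P = P + iharaSum (fun u y => aeval (Fin.cons u y) P) X :=
  rfl

theorem tailIharaOp_apply (P : MvPolynomial (Fin (s + 2)) ℚ) :
    tailIharaOp s P =
      P + iharaSum (fun u y => aeval (Fin.cons (X 0) (Fin.cons u y)) P) (Fin.tail X) :=
  rfl

theorem aeval_aeval_cons {B : Type*} [CommRing B] [Algebra ℚ B] (φ : A →ₐ[ℚ] B) (x : A)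
    (y : Fin s → A) (P : MvPolynomial (Fin (s + 1)) ℚ) :
    φ (aeval (Fin.cons x y : Fin (s + 1) → A) P) =
      aeval (Fin.cons (φ x) (φ ∘ y) : Fin (s + 1) → B) P := by
  rw [← Fin.comp_cons, ← AlgHom.comp_apply, comp_aeval]
  rfl

theorem aeval_iharaOp (z : Fin (s + 1) → A) (P : MvPolynomial (Fin (s + 1)) ℚ) :
    aeval z (iharaOp s P) = aeval z P + iharaSum (fun u y => aeval (Fin.cons u y) P) z := by
  rw [iharaOp_apply, map_add,
    map_iharaSum (g' := fun u y => aeval (Fin.cons u y) P) (aeval z) (aeval (R := ℚ) z)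
      (map_sub _) fun u y => aeval_aeval_cons _ u y P]
  congr 2
  funext i
  exact aeval_X z i

theorem aeval_tailIharaOp (z : Fin (s + 2) → A) (P : MvPolynomial (Fin (s + 2)) ℚ) :
    aeval z (tailIharaOp s P) = aeval z P +
      iharaSum (fun u y => aeval (Fin.cons (z 0) (Fin.cons u y)) P) (Fin.tail z) := by
  rw [tailIharaOp_apply, map_add,
    map_iharaSum (g' := fun u y => aeval (Fin.cons (z 0) (Fin.cons u y)) P)
      (aeval (R := ℚ) z) (aeval (R := ℚ) z) (map_sub _) fun u y => by
        rw [aeval_aeval_cons, Fin.comp_cons, aeval_X]]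
  congr 2
  funext i
  exact aeval_X z i.succ

theorem aeval_toPoly_neg_cons (v : Vect N (s + 1)) (x : A) (y : Fin s → A) :
    aeval (Fin.cons (-x) y : Fin (s + 1) → A) (toPoly N (s + 1) v) =
      aeval (Fin.cons x y : Fin (s + 1) → A) (toPoly N (s + 1) v) := by
  simp only [toPoly_apply, map_sum, map_smul]
  refine Finset.sum_congr rfl fun m _ => ?_
  rw [aeval_monomial, aeval_monomial, Finsupp.prod_fintype _ _ fun _ => pow_zero _,
    Finsupp.prod_fintype _ _ fun _ => pow_zero _, Fin.prod_univ_succ, Fin.prod_univ_succ]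
  simp only [Fin.cons_zero, Fin.cons_succ, (even_expo m 0).neg_pow]

theorem aeval_toPoly_relation {v : Vect N (s + 2)} (hv : v ∈ vecW N (s + 2) (Nat.le_add_left 2 s))
    (x y : A) (t : Fin s → A) :
    aeval (Fin.cons x (Fin.cons y t) : Fin (s + 2) → A) (toPoly N (s + 2) v) =
      aeval (Fin.cons (y - x) (Fin.cons y t) : Fin (s + 2) → A) (toPoly N (s + 2) v) -
        aeval (Fin.cons (y - x) (Fin.cons x t) : Fin (s + 2) → A) (toPoly N (s + 2) v) := by
  have h := congrArg (aeval (Fin.cons x (Fin.cons y t) : Fin (s + 2) → A)) (mem_vecW.1 hv)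
  rw [map_sub, substA, substB, ← AlgHom.comp_apply, ← AlgHom.comp_apply, comp_aeval,
    comp_aeval] at h
  convert h using 4 <;>
  · funext i
    refine Fin.cases ?_ (fun j => Fin.cases ?_ (fun k => ?_) j) i <;> simp

theorem aeval_toPoly_antisymm {v : Vect N (s + 2)} (hv : v ∈ vecW N (s + 2) (Nat.le_add_left 2 s))
    (x y : A) (t : Fin s → A) :
    aeval (Fin.cons x (Fin.cons y t) : Fin (s + 2) → A) (toPoly N (s + 2) v) =
      -aeval (Fin.cons y (Fin.cons x t) : Fin (s + 2) → A) (toPoly N (s + 2) v) :=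
  antisymm_of_relation
    (f := fun x y t => aeval (Fin.cons x (Fin.cons y t) : Fin (s + 2) → A) (toPoly N (s + 2) v))
    (fun _ _ _ => aeval_toPoly_neg_cons _ _ _) (aeval_toPoly_relation hv) x y t

theorem iharaOp_add_tailIharaOp {v : Vect N (s + 2)}
    (hv : v ∈ vecW N (s + 2) (Nat.le_add_left 2 s)) :
    iharaOp (s + 1) (toPoly N (s + 2) v) + tailIharaOp s (toPoly N (s + 2) v) =
      toPoly N (s + 2) v := by
  suffices h : ∀ x (y : Fin (s + 1) → MvPolynomial (Fin (s + 2)) ℚ),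
      aeval (Fin.cons x y) (iharaOp (s + 1) (toPoly N (s + 2) v)) +
        aeval (Fin.cons x y) (tailIharaOp s (toPoly N (s + 2) v)) =
          aeval (Fin.cons x y) (toPoly N (s + 2) v) by
    simpa only [Fin.cons_self_tail, aeval_X_left_apply] using h (X 0) (Fin.tail X)
  intro x y
  have hrel := aeval_toPoly_relation hv x (y 0) (Fin.tail y)
  rw [Fin.cons_self_tail] at hrel
  rw [aeval_iharaOp, aeval_tailIharaOp, iharaSum_cons, Fin.cons_zero, Fin.tail_cons, hrel]
  simp only [aeval_toPoly_antisymm hv x, iharaSum_neg]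
  ring

theorem iharaOp_tailIharaOp {v : Vect N (s + 2)}
    (hv : v ∈ vecW N (s + 2) (Nat.le_add_left 2 s)) :
    iharaOp (s + 1) (tailIharaOp s (toPoly N (s + 2) v)) = 0 := by
  have hsum := iharaSum_iharaSum_eq_zero
    (fun (x y : MvPolynomial (Fin (s + 2)) ℚ) t =>
      aeval (Fin.cons x (Fin.cons y t) : Fin (s + 2) → MvPolynomial (Fin (s + 2)) ℚ)
        (toPoly N (s + 2) v))
    (aeval_toPoly_antisymm hv) (aeval_toPoly_relation hv) X
  have hadd := iharaOp_add_tailIharaOp hv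
  rw [iharaOp_apply] at hadd ⊢
  simp only [aeval_tailIharaOp, Fin.cons_zero, Fin.tail_cons, iharaSum_add, hsum]
  linear_combination hadd

end Operators

section Coefficients

open MvPolynomial

variable {s N : ℕ}

theorem aeval_cons_monomial {A : Type*} [CommRing A] [Algebra ℚ A] (x : A) (y : Fin s → A)
    (d : Fin (s + 1) →₀ ℕ) :
    aeval (Fin.cons x y : Fin (s + 1) → A) (monomial d (1 : ℚ)) =
      x ^ d 0 * aeval y (monomial d.tail (1 : ℚ)) := by
  simp only [aeval_monomial, map_one, one_mul, Finsupp.prod_fintype _ _ fun _ => pow_zero _,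
    Fin.prod_univ_succ, Fin.cons_zero, Fin.cons_succ, Finsupp.tail_apply]

theorem monomial_eq_X_pow_mul_rename (d : Fin (s + 1) →₀ ℕ) :
    monomial d (1 : ℚ) = X 0 ^ d 0 * rename Fin.succ (monomial d.tail (1 : ℚ)) := by
  have h := aeval_cons_monomial (X 0 : MvPolynomial (Fin (s + 1)) ℚ) (Fin.tail X) d
  rw [Fin.cons_self_tail, aeval_X_left_apply] at h
  rw [rename_eq_aeval]
  exact h

theorem aeval_removeNth_X (p : Fin (s + 1)) (P : MvPolynomial (Fin s) ℚ) :
    aeval (p.removeNth (X : Fin (s + 1) → MvPolynomial (Fin (s + 1)) ℚ)) P =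
      rename p.succAbove P := by
  rw [rename_eq_aeval]
  rfl

theorem iharaOp_monomial (d : Fin (s + 1) →₀ ℕ) :
    iharaOp s (monomial d 1) = ihara (d 0) (monomial d.tail 1) := by
  simp only [iharaOp_apply, iharaSum, aeval_cons_monomial, aeval_removeNth_X, ihara, ← mul_pow,
    neg_one_mul, neg_sub]
  rw [monomial_eq_X_pow_mul_rename]

theorem tailIharaOp_monomial (d : Fin (s + 2) →₀ ℕ) :
    tailIharaOp s (monomial d 1) =
      X 0 ^ d 0 * rename Fin.succ (iharaOp s (monomial d.tail (1 : ℚ))) := by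
  rw [rename_eq_aeval, aeval_iharaOp, ← rename_eq_aeval, mul_add, ← monomial_eq_X_pow_mul_rename,
    tailIharaOp_apply]
  simp only [aeval_cons_monomial _ _ d, iharaSum, ← mul_sub, Finset.mul_sum]
  rfl

theorem finSuccEquiv_rename_succ (Q : MvPolynomial (Fin s) ℚ) :
    finSuccEquiv ℚ s (rename Fin.succ Q) = Polynomial.C Q := by
  have h : (finSuccEquiv ℚ s).toAlgHom.comp (rename Fin.succ) = Polynomial.CAlgHom :=
    algHom_ext fun i => by simp [finSuccEquiv_X_succ]
  exact DFunLike.congr_fun h Q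

theorem coeff_X_pow_mul_rename_succ (a : ℕ) (Q : MvPolynomial (Fin s) ℚ) (n : Fin (s + 1) →₀ ℕ) :
    coeff n (X 0 ^ a * rename Fin.succ Q) = if n 0 = a then coeff n.tail Q else 0 := by
  conv_lhs => rw [← n.cons_tail]
  rw [← finSuccEquiv_coeff_coeff, map_mul, map_pow, finSuccEquiv_X_zero, finSuccEquiv_rename_succ,
    Polynomial.coeff_X_pow_mul', Polynomial.coeff_C]
  split_ifs <;> first | rfl | omega

theorem e_eq_coeff (m n : Fin (s + 1) → ℕ) :
    e m n = coeff (expo n) (iharaOp s (monomial (expo m) 1)) := by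
  rw [iharaOp_monomial]
  rfl

theorem vecMul_E (v : Vect N (s + 1)) (n : S N (s + 1)) :
    Matrix.vecMul v (E N (s + 1)) n = coeff (expo n.1) (iharaOp s (toPoly N (s + 1) v)) := by
  simp only [toPoly_apply, map_sum, map_smul, coeff_sum, coeff_smul, ← e_eq_coeff]
  rfl

theorem Ej_tail (h : s + 1 ≤ s + 2) (m n : S N (s + 2)) :
    Ej N (s + 2) (s + 1) h m n = coeff (expo n.1) (tailIharaOp s (monomial (expo m.1) 1)) := by
  have hlast (m : Fin (s + 2) → ℕ) : lastEntries (s + 1) h m = Fin.tail m := by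
    funext k
    refine congrArg m (Fin.ext ?_)
    rw [Fin.val_succ, Fin.val_mk]
    omega
  have hfirst : (∀ i : Fin (s + 2), i.val < s + 2 - (s + 1) → m.1 i = n.1 i) ↔
      expo n.1 0 = expo m.1 0 := by
    have hm := ((mem_S.1 m.2).2 0).1
    have hn := ((mem_S.1 n.2).2 0).1
    rw [expo_apply, expo_apply]
    refine ⟨fun hc => by rw [hc 0 (by simp)], fun hc i hi => ?_⟩
    obtain rfl : i = 0 := Fin.ext (show i.val = 0 by omega)
    omega
  rw [tailIharaOp_monomial, coeff_X_pow_mul_rename_succ, Ej, Matrix.of_apply]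
  simp only [hfirst, hlast]
  rw [e_eq_coeff, ite_mul, one_mul, zero_mul]
  rfl

theorem vecMul_Ej_tail (h : s + 1 ≤ s + 2) (v : Vect N (s + 2)) (n : S N (s + 2)) :
    Matrix.vecMul v (Ej N (s + 2) (s + 1) h) n =
      coeff (expo n.1) (tailIharaOp s (toPoly N (s + 2) v)) := by
  simp only [toPoly_apply, map_sum, map_smul, coeff_sum, coeff_smul, ← Ej_tail h]
  rfl

theorem eq_of_coeff_mul_rename_ne_zero {p : Fin (s + 1)} {i j : Fin s} (hj : j ≠ i)
    {u : MvPolynomial (Fin (s + 1)) ℚ} (hu : u.vars ⊆ {p, p.succAbove i}) {t : Fin s →₀ ℕ}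
    {n : Fin (s + 1) →₀ ℕ}
    (h : coeff n (u * rename p.succAbove (monomial t (1 : ℚ))) ≠ 0) :
    n (p.succAbove j) = t j := by
  rw [rename_monomial, coeff_mul_monomial', ite_ne_right_iff, mul_one] at h
  have hvars : p.succAbove j ∉ u.vars := fun hmem => by
    simpa [Fin.succAbove_ne, hj] using hu hmem
  have hzero := mem_support_notMem_vars_zero (mem_support_iff.2 h.2) hvars
  rw [← Finsupp.mapDomain_apply Fin.succAbove_right_injective t j]
  exact (Nat.sub_eq_zero_iff_le.1 hzero).antisymm (h.1 _)

theorem vars_X_sub_X_pow_subset {σ : Type*} [DecidableEq σ] (a b : σ) (k : ℕ) :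
    ((X a - X b : MvPolynomial σ ℚ) ^ k).vars ⊆ {a, b} := by
  refine (vars_pow _ _).trans ((vars_sub_subset _).trans ?_)
  rw [vars_X, vars_X]
  rfl

theorem rename_succAbove_succ_eq_castSucc {i : Fin s} {t : Fin s →₀ ℕ} (ht : t i = 0) :
    rename i.succ.succAbove (monomial t (1 : ℚ)) =
      rename i.castSucc.succAbove (monomial t (1 : ℚ)) := by
  rw [rename_monomial, rename_monomial, Finsupp.mapDomain_congr]
  intro j hj
  have hji : j ≠ i := fun h => Finsupp.mem_support_iff.1 hj (h ▸ ht)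
  rcases hji.lt_or_gt with hlt | hlt
  · rw [Fin.succAbove_succ_of_le _ _ hlt.le, Fin.succAbove_castSucc_of_lt _ _ hlt]
  · rw [Fin.succAbove_succ_of_lt _ _ hlt, Fin.succAbove_castSucc_of_le _ _ hlt.le]

/-- Each term of the Ihara action only mixes the exponents of one pair of neighbours, so the
remaining exponents of `d` occur in `n`; the last one is even by parity and nonzero since
otherwise the two terms cancel. -/
theorem even_and_ne_zero_of_coeff_iharaOp_ne_zero {d n : Fin (s + 1) →₀ ℕ}
    (hn : ∀ i, Even (n i) ∧ n i ≠ 0) (hd₀ : Even (d 0) ∧ d 0 ≠ 0) (hd : Even d.degree)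
    (h : coeff n (iharaOp s (monomial d 1)) ≠ 0) (i : Fin (s + 1)) : Even (d i) ∧ d i ≠ 0 := by
  rw [iharaOp_apply, coeff_add, coeff_monomial] at h
  rcases eq_or_ne d n with rfl | hdn
  · exact hn i
  rw [if_neg hdn, zero_add, iharaSum, coeff_sum] at h
  obtain ⟨k, -, hk⟩ := Finset.exists_ne_zero_of_sum_ne_zero h
  simp only [aeval_cons_monomial, aeval_removeNth_X, coeff_sub] at hk
  have hother (j : Fin s) (hj : j ≠ k) : Even (d j.succ) ∧ d j.succ ≠ 0 := by
    obtain ⟨p, hp, hcoeff⟩ : ∃ p : Fin (s + 1),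
        ({k.succ, k.castSucc} : Finset (Fin (s + 1))) ⊆ {p, p.succAbove k} ∧
          coeff n ((X k.succ - X k.castSucc) ^ d 0 *
            rename p.succAbove (monomial d.tail (1 : ℚ))) ≠ 0 := by
      by_contra! hc
      refine hk ?_
      rw [hc k.castSucc, hc k.succ, sub_zero]
      · rw [Fin.succAbove_succ_self]
      · rw [Fin.succAbove_castSucc_self, Finset.pair_comm]
    rw [← Finsupp.tail_apply,
      ← eq_of_coeff_mul_rename_ne_zero hj ((vars_X_sub_X_pow_subset _ _ _).trans hp) hcoeff]
    exact hn _
  refine Fin.cases hd₀ (fun j => ?_) i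
  rcases eq_or_ne j k with rfl | hj
  · refine ⟨?_, fun hzero => ?_⟩
    · have hsum : Even (∑ l ∈ Finset.univ.erase j, d l.succ) :=
        Finset.even_sum _ fun l hl => (hother l (Finset.ne_of_mem_erase hl)).1
      rw [Finsupp.degree_eq_sum, Fin.sum_univ_succ, ← Finset.add_sum_erase _ _ (Finset.mem_univ j),
        Nat.even_add, Nat.even_add] at hd
      tauto
    · rw [rename_succAbove_succ_eq_castSucc ((Finsupp.tail_apply _ _).trans hzero), sub_self] at hk
      exact hk rfl
  · exact hother j hj

theorem isHomogeneous_tailIharaOp {k : ℕ} {P : MvPolynomial (Fin (s + 2)) ℚ}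
    (hP : P.IsHomogeneous k) : (tailIharaOp s P).IsHomogeneous k := by
  have hcons (u : MvPolynomial (Fin (s + 2)) ℚ) (hu : u.IsHomogeneous 1)
      (f : Fin s → Fin (s + 2)) :
      (aeval (Fin.cons (X 0) (Fin.cons u fun j => X (f j)) :
        Fin (s + 2) → MvPolynomial (Fin (s + 2)) ℚ) P).IsHomogeneous k := by
    have h := hP.aeval (n := 1) (Fin.cons (X 0) (Fin.cons u fun j => X (f j)) :
      Fin (s + 2) → MvPolynomial (Fin (s + 2)) ℚ)
      (Fin.cases (isHomogeneous_X _ _) (Fin.cases hu fun j => isHomogeneous_X _ _))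
    rwa [one_mul] at h
  have hsub (i j : Fin (s + 2)) : (X i - X j : MvPolynomial (Fin (s + 2)) ℚ).IsHomogeneous 1 :=
    (isHomogeneous_X _ _).sub (isHomogeneous_X _ _)
  rw [tailIharaOp_apply]
  exact hP.add (IsHomogeneous.sum _ _ _ fun i _ =>
    (hcons _ (hsub _ _) _).sub (hcons _ (hsub _ _) _))

theorem apply_zero_eq_of_coeff_tailIharaOp_ne_zero {m d : Fin (s + 2) →₀ ℕ}
    (h : coeff d (tailIharaOp s (monomial m 1)) ≠ 0) : d 0 = m 0 := by
  rw [tailIharaOp_monomial, coeff_X_pow_mul_rename_succ] at h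
  exact (ite_ne_right_iff.1 h).1

theorem degree_eq_of_coeff_tailIharaOp_ne_zero {m d : Fin (s + 2) →₀ ℕ}
    (h : coeff d (tailIharaOp s (monomial m 1)) ≠ 0) : d.degree = m.degree := by
  by_contra hne
  exact h ((isHomogeneous_tailIharaOp (isHomogeneous_monomial 1 rfl)).coeff_eq_zero hne)

theorem exists_of_coeff_tailIharaOp_toPoly_ne_zero {v : Vect N (s + 2)} {d : Fin (s + 2) →₀ ℕ}
    (h : coeff d (tailIharaOp s (toPoly N (s + 2) v)) ≠ 0) :
    ∃ m : S N (s + 2), d 0 = expo m.1 0 ∧ d.degree = (expo m.1).degree := by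
  rw [toPoly_apply, map_sum, coeff_sum] at h
  obtain ⟨m, -, hm⟩ := Finset.exists_ne_zero_of_sum_ne_zero h
  rw [map_smul, coeff_smul] at hm
  have hm := right_ne_zero_of_mul hm
  exact ⟨m, apply_zero_eq_of_coeff_tailIharaOp_ne_zero hm,
    degree_eq_of_coeff_tailIharaOp_ne_zero hm⟩

/-- Truncating `tailIharaOp s P` to the totally even part, as the matrix does, loses nothing: the
discarded monomials still have an even first exponent and an even degree, so their images under
`iharaOp` have no coefficients at totally even exponents. -/
theorem vecMul_Ej_tail_vecMul_E (h : s + 1 ≤ s + 2) (v : Vect N (s + 2)) (n : S N (s + 2)) :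
    Matrix.vecMul (Matrix.vecMul v (Ej N (s + 2) (s + 1) h)) (E N (s + 2)) n =
      coeff (expo n.1) (iharaOp (s + 1) (tailIharaOp s (toPoly N (s + 2) v))) := by
  set u := Matrix.vecMul v (Ej N (s + 2) (s + 1) h) with hu
  set D := tailIharaOp s (toPoly N (s + 2) v) - toPoly N (s + 2) u with hD
  suffices hzero : coeff (expo n.1) (iharaOp (s + 1) D) = 0 by
    rw [hD, map_sub, coeff_sub, sub_eq_zero] at hzero
    rw [vecMul_E, hzero]
  rw [D.as_sum, map_sum, coeff_sum]
  refine Finset.sum_eq_zero fun d hd => ?_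
  rw [mem_support_iff] at hd
  have hnot : ¬∃ m : S N (s + 2), expo m.1 = d := by
    rintro ⟨m, rfl⟩
    rw [hD, coeff_sub, coeff_toPoly, hu, vecMul_Ej_tail, sub_self] at hd
    exact hd rfl
  have hcoeff : coeff d (toPoly N (s + 2) u) = 0 :=
    notMem_support_iff.1 fun hmem => hnot (exists_expo_eq_of_mem_support hmem)
  rw [hD, coeff_sub, hcoeff, sub_zero] at hd
  obtain ⟨m, hd₀, hdeg⟩ := exists_of_coeff_tailIharaOp_toPoly_ne_zero hd
  obtain ⟨hm, hmN⟩ := exists_expo_eq_iff.1 ⟨m, rfl⟩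
  have hdeven : Even d.degree := by
    rw [hdeg, Finsupp.degree_eq_sum]
    exact Finset.even_sum _ fun i _ => even_expo m i
  rw [← mul_one (coeff d D), ← smul_eq_mul, ← smul_monomial, map_smul, coeff_smul]
  refine smul_eq_zero_of_right _ (by_contra fun hne => hnot (exists_expo_eq_iff.2 ⟨?_, hdeg ▸ hmN⟩))
  exact even_and_ne_zero_of_coeff_iharaOp_ne_zero (exists_expo_eq_iff.1 ⟨n, rfl⟩).1
    (hd₀ ▸ hm 0) hdeven hne

theorem vecMul_F_eq_neg {v : Vect N (s + 2)} (hv : v ∈ vecW N (s + 2) (Nat.le_add_left 2 s)) :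
    Matrix.vecMul v (F N (s + 2)) =
      -Matrix.vecMul v (Ej N (s + 2) (s + 1) (Nat.le_succ _)) := by
  funext n
  have h := congrArg (coeff (expo n.1)) (iharaOp_add_tailIharaOp hv)
  rw [coeff_add, ← vecMul_E, ← vecMul_Ej_tail (Nat.le_succ _), coeff_toPoly] at h
  rw [F, Matrix.vecMul_sub, Matrix.vecMul_one, Pi.sub_apply, Pi.neg_apply]
  linear_combination h

theorem vecMul_F_vecMul_E {v : Vect N (s + 2)}
    (hv : v ∈ vecW N (s + 2) (Nat.le_add_left 2 s)) :
    Matrix.vecMul (Matrix.vecMul v (F N (s + 2))) (E N (s + 2)) = 0 := by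
  funext n
  rw [vecMul_F_eq_neg hv, Matrix.neg_vecMul, Pi.neg_apply, vecMul_Ej_tail_vecMul_E,
    iharaOp_tailIharaOp hv, coeff_zero, neg_zero, Pi.zero_apply]

end Coefficients

/-! ### Outer products -/

section Outer

open MvPolynomial

variable {N a b p q : ℕ}

/-- Extension of a coefficient vector by zero to all tuples. -/
def extendZero (v : Vect a p) (m : Fin p → ℕ) : ℚ := if h : m ∈ S a p then v ⟨m, h⟩ else 0

theorem extendZero_of_mem (v : Vect a p) {m : Fin p → ℕ} (h : m ∈ S a p) :
    extendZero v m = v ⟨m, h⟩ :=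
  dif_pos h

theorem extendZero_of_notMem (v : Vect a p) {m : Fin p → ℕ} (h : m ∉ S a p) :
    extendZero v m = 0 :=
  dif_neg h

theorem sum_mul_ite_eq_extendZero (v : Vect a p) (n : Fin p → ℕ) :
    ∑ m : S a p, v m * (if m.1 = n then 1 else 0) = extendZero v n := by
  simp only [mul_ite, mul_one, mul_zero]
  by_cases hn : n ∈ S a p
  · rw [extendZero_of_mem v hn, Fintype.sum_eq_single ⟨n, hn⟩ fun m hm =>
      if_neg fun h => hm (Subtype.ext h), if_pos rfl]
  · rw [extendZero_of_notMem v hn]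
    exact Finset.sum_eq_zero fun m _ => if_neg fun h : m.1 = n => hn (h ▸ m.2)

/-- The outer product of two coefficient vectors; it corresponds to the product of two polynomials
in disjoint sets of variables (see `toPoly_outer`) and is meant for `N = a + b`. -/
def outer (N : ℕ) (v : Vect a p) (w : Vect b q) : Vect N (p + q) := fun n =>
  extendZero v (fun i => n.1 (Fin.castAdd q i)) * extendZero w (fun i => n.1 (Fin.natAdd p i))

theorem append_mem_S (h : a + b = N) {m : Fin p → ℕ} (hm : m ∈ S a p) {n : Fin q → ℕ} :
    Fin.append m n ∈ S N (p + q) ↔ n ∈ S b q := by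
  rw [mem_S] at hm
  simp only [mem_S, Fin.sum_univ_add, Fin.forall_fin_add, Fin.append_left, Fin.append_right, hm.1,
    ← h, add_right_inj, and_iff_right hm.2]

/-- Concatenation of tuples. -/
def concat (h : a + b = N) (x : S a p × S b q) : S N (p + q) :=
  ⟨Fin.append x.1.1 x.2.1, (append_mem_S h x.1.2).2 x.2.2⟩

theorem concat_injective (h : a + b = N) : Function.Injective (concat (p := p) (q := q) h) := by
  intro x y hxy
  have hentry := congrFun (congrArg Subtype.val hxy)
  refine Prod.ext (Subtype.ext (funext fun i => ?_)) (Subtype.ext (funext fun i => ?_))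
  · simpa only [concat, Fin.append_left] using hentry (Fin.castAdd q i)
  · simpa only [concat, Fin.append_right] using hentry (Fin.natAdd p i)

theorem outer_append (v : Vect a p) (w : Vect b q) {m : Fin p → ℕ} {n : Fin q → ℕ}
    (h : Fin.append m n ∈ S N (p + q)) :
    outer N v w ⟨Fin.append m n, h⟩ = extendZero v m * extendZero w n := by
  simp only [outer, Fin.append_left, Fin.append_right]

theorem sum_outer_smul {M : Type*} [AddCommGroup M] [Module ℚ M] (h : a + b = N)
    (v : Vect a p) (w : Vect b q) (g : (Fin (p + q) → ℕ) → M) :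
    ∑ n : S N (p + q), outer N v w n • g n.1 =
      ∑ m : S a p, ∑ n : S b q, (v m * w n) • g (Fin.append m.1 n.1) := by
  rw [← Fintype.sum_prod_type' fun (m : S a p) (n : S b q) =>
    (v m * w n) • g (Fin.append m.1 n.1)]
  symm
  refine Fintype.sum_of_injective (concat h) (concat_injective h) _ _ ?_ fun x => ?_
  · rintro ⟨n, hn⟩ hrange
    obtain ⟨n₁, n₂, rfl⟩ : ∃ n₁ n₂, n = Fin.append n₁ n₂ :=
      ⟨_, _, Fin.append_castAdd_natAdd.symm⟩
    rw [outer_append]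
    by_cases hleft : n₁ ∈ S a p
    · exact absurd ⟨(⟨_, hleft⟩, ⟨_, (append_mem_S h hleft).1 hn⟩), rfl⟩ hrange
    · rw [extendZero_of_notMem _ hleft, zero_mul, zero_smul]
  · rw [concat, outer_append, extendZero_of_mem _ x.1.2, extendZero_of_mem _ x.2.2]

theorem monomial_expo_append (m : Fin p → ℕ) (n : Fin q → ℕ) :
    monomial (expo (Fin.append m n)) (1 : ℚ) =
      rename (Fin.castAdd q) (monomial (expo m) 1) *
        rename (Fin.natAdd p) (monomial (expo n) 1) := by
  simp only [monomial_eq, Finsupp.prod_pow, Fin.prod_univ_add, map_prod, map_pow,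
    rename_X, map_one, one_mul, expo_apply, Fin.append_left, Fin.append_right]

theorem toPoly_outer (h : a + b = N) (v : Vect a p) (w : Vect b q) :
    toPoly N (p + q) (outer N v w) =
      rename (Fin.castAdd q) (toPoly a p v) * rename (Fin.natAdd p) (toPoly b q w) := by
  rw [toPoly_apply, sum_outer_smul h v w (fun n => monomial (expo n) (1 : ℚ)), toPoly_apply,
    toPoly_apply, map_sum, map_sum, Finset.sum_mul_sum]
  refine Finset.sum_congr rfl fun m _ => Finset.sum_congr rfl fun n _ => ?_
  rw [monomial_expo_append, map_smul, map_smul, smul_mul_smul_comm]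

theorem substA_rename_castAdd (P : MvPolynomial (Fin 2) ℚ) :
    substA (Nat.le_add_right 2 q) (rename (Fin.castAdd q) P) =
      rename (Fin.castAdd q) (substA le_rfl P) := by
  rw [← AlgHom.comp_apply, ← AlgHom.comp_apply]
  refine DFunLike.congr_fun (algHom_ext fun i => ?_) P
  simp only [AlgHom.comp_apply, rename_X, substA, aeval_X, Fin.val_castAdd]
  split_ifs <;> simp only [map_sub, rename_X, Fin.castAdd_mk]

theorem substB_rename_castAdd (P : MvPolynomial (Fin 2) ℚ) :
    substB (Nat.le_add_right 2 q) (rename (Fin.castAdd q) P) =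
      rename (Fin.castAdd q) (substB le_rfl P) := by
  rw [← AlgHom.comp_apply, ← AlgHom.comp_apply]
  refine DFunLike.congr_fun (algHom_ext fun i => ?_) P
  simp only [AlgHom.comp_apply, rename_X, substB, aeval_X, Fin.val_castAdd]
  split_ifs <;> simp only [map_sub, rename_X, Fin.castAdd_mk]

theorem substA_rename_natAdd (P : MvPolynomial (Fin q) ℚ) :
    substA (Nat.le_add_right 2 q) (rename (Fin.natAdd 2) P) = rename (Fin.natAdd 2) P := by
  rw [← AlgHom.comp_apply]
  refine DFunLike.congr_fun (algHom_ext fun i => ?_) P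
  rw [AlgHom.comp_apply, rename_X, substA, aeval_X, if_neg (by simp)]

theorem substB_rename_natAdd (P : MvPolynomial (Fin q) ℚ) :
    substB (Nat.le_add_right 2 q) (rename (Fin.natAdd 2) P) = rename (Fin.natAdd 2) P := by
  rw [← AlgHom.comp_apply]
  refine DFunLike.congr_fun (algHom_ext fun i => ?_) P
  rw [AlgHom.comp_apply, rename_X, substB, aeval_X, if_neg (by simp),
    if_neg (by rw [Fin.val_natAdd]; omega)]

theorem outer_mem_vecW (h : a + b = N) {v : Vect a 2} (hv : v ∈ vecW a 2 le_rfl) (w : Vect b q) :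
    outer N v w ∈ vecW N (2 + q) (Nat.le_add_right 2 q) := by
  rw [mem_vecW] at hv ⊢
  rw [toPoly_outer h, map_mul, map_mul, substA_rename_castAdd, substB_rename_castAdd,
    substA_rename_natAdd, substB_rename_natAdd, ← sub_mul, ← map_sub, ← hv]

theorem lastEntries_append {j : ℕ} (hj : j ≤ q) (hj' : j ≤ p + q) (m : Fin p → ℕ)
    (n : Fin q → ℕ) : lastEntries j hj' (Fin.append m n) = lastEntries j hj n := by
  ext k
  rw [lastEntries, lastEntries, ← Fin.append_right m n]
  congr 1
  ext
  simp only [Fin.val_natAdd]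
  omega

theorem append_eq_append_of_lt_iff {j : ℕ} (hj : j ≤ q) (m m' : Fin p → ℕ) (n n' : Fin q → ℕ) :
    (∀ i : Fin (p + q), i.val < p + q - j → Fin.append m n i = Fin.append m' n' i) ↔
      m = m' ∧ ∀ i : Fin q, i.val < q - j → n i = n' i := by
  have hleft (i : Fin p) : i.val < p + q - j := by omega
  have hright (i : Fin q) : p + i.val < p + q - j ↔ i.val < q - j := by omega
  simp only [Fin.forall_fin_add, Fin.val_castAdd, Fin.val_natAdd, Fin.append_left,
    Fin.append_right, hleft, hright, forall_const, funext_iff]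

theorem vecMul_outer_Ej {j : ℕ} (h : a + b = N) (v : Vect a p) (w : Vect b q) (hj : j ≤ q)
    (hj' : j ≤ p + q) :
    Matrix.vecMul (outer N v w) (Ej N (p + q) j hj') =
      outer N v (Matrix.vecMul w (Ej b q j hj)) := by
  ext ⟨n, hn⟩
  obtain ⟨n₁, n₂, rfl⟩ : ∃ n₁ n₂, n = Fin.append n₁ n₂ := ⟨_, _, Fin.append_castAdd_natAdd.symm⟩
  refine (sum_outer_smul h v w fun m : Fin (p + q) → ℕ =>
    ((if ∀ i : Fin (p + q), i.val < p + q - j → m i = Fin.append n₁ n₂ i then (1 : ℚ) else 0) *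
      e (lastEntries j hj' m) (lastEntries j hj' (Fin.append n₁ n₂)))).trans ?_
  have hfactor (m : S a p) (m' : S b q) :
      (v m * w m') • ((if m.1 = n₁ ∧ ∀ i : Fin q, i.val < q - j → m'.1 i = n₂ i then (1 : ℚ)
        else 0) * e (lastEntries j hj m'.1) (lastEntries j hj n₂)) =
      (v m * if m.1 = n₁ then 1 else 0) *
        (w m' * ((if ∀ i : Fin q, i.val < q - j → m'.1 i = n₂ i then 1 else 0) *
          e (lastEntries j hj m'.1) (lastEntries j hj n₂))) := by
    rw [ite_and, smul_eq_mul]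
    split_ifs <;> ring
  simp only [append_eq_append_of_lt_iff hj, lastEntries_append hj, hfactor, ← Finset.sum_mul_sum,
    sum_mul_ite_eq_extendZero, outer_append]
  by_cases hleft : n₁ ∈ S a p
  · rw [extendZero_of_mem (Matrix.vecMul w _) ((append_mem_S h hleft).1 hn)]
    rfl
  · rw [extendZero_of_notMem v hleft, zero_mul, zero_mul]

theorem linearIndependent_mul {R X Y ι κ : Type*} [CommRing R] [Finite ι] [Finite κ]
    {u : ι → X → R} {w : κ → Y → R} (hu : LinearIndependent R u) (hw : LinearIndependent R w) :
    LinearIndependent R fun (i : ι × κ) (x : X × Y) => u i.1 x.1 * w i.2 x.2 := by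
  cases nonempty_fintype ι
  cases nonempty_fintype κ
  rw [Fintype.linearIndependent_iff] at hu hw ⊢
  rintro g hg ⟨i, j⟩
  refine hw (fun j => g (i, j)) (funext fun y => ?_) j
  have hcoeff := hu (fun i => ∑ j, g (i, j) * w j y) (funext fun x => ?_) i
  · simpa only [Finset.sum_apply, Pi.smul_apply, smul_eq_mul, Pi.zero_apply] using hcoeff
  · have h := congrFun hg (x, y)
    simp only [Fintype.sum_prod_type, Finset.sum_apply, Pi.smul_apply, smul_eq_mul,
      Pi.zero_apply] at h
    simp only [Finset.sum_apply, Pi.smul_apply, smul_eq_mul, Finset.sum_mul, Pi.zero_apply]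
    rw [← h]
    exact Finset.sum_congr rfl fun i _ => Finset.sum_congr rfl fun j _ => by ring

theorem linearIndependent_sigma_of_map {R M ι : Type*} {κ : ι → Type*} {M' : ι → Type*} [Ring R]
    [AddCommGroup M] [Module R M] [∀ i, AddCommGroup (M' i)] [∀ i, Module R (M' i)] [Finite ι]
    [∀ i, Finite (κ i)] {u : (Σ i, κ i) → M} (f : ∀ i, M →ₗ[R] M' i)
    (hne : ∀ i j, j ≠ i → ∀ k, f i (u ⟨j, k⟩) = 0)
    (hindep : ∀ i, LinearIndependent R fun k => f i (u ⟨i, k⟩)) : LinearIndependent R u := by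
  cases nonempty_fintype ι
  have (i : ι) := Fintype.ofFinite (κ i)
  rw [Fintype.linearIndependent_iff]
  rintro g hg ⟨i, k⟩
  refine Fintype.linearIndependent_iff.1 (hindep i) (fun k => g ⟨i, k⟩) ?_ k
  have h := congrArg (f i) hg
  rw [map_zero, Fintype.sum_sigma, map_sum, Fintype.sum_eq_single i fun j hj => ?_] at h
  · simpa only [map_sum, map_smul] using h
  · simp only [map_sum, map_smul, hne i j hj, smul_zero, Finset.sum_const_zero]

theorem outer_comp_concat (h : a + b = N) (v : Vect a p) (w : Vect b q) :
    outer N v w ∘ concat h = fun x => v x.1 * w x.2 := by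
  funext x
  exact (outer_append v w _).trans
    (by rw [extendZero_of_mem v x.1.2, extendZero_of_mem w x.2.2])

theorem outer_comp_concat_of_ne {a' b' : ℕ} (h : a + b = N) (ha : a' ≠ a) (v : Vect a' p)
    (w : Vect b' q) : outer N v w ∘ concat h = 0 := by
  funext x
  refine (outer_append v w _).trans ?_
  rw [extendZero_of_notMem v fun hm => ha ((mem_S.1 hm).1.symm.trans (mem_S.1 x.1.2).1), zero_mul]
  rfl

theorem sum_finrank_mul_le (A : ∀ a, Submodule ℚ (Vect a p)) (B : ∀ b, Submodule ℚ (Vect b q))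
    (U : Submodule ℚ (Vect N (p + q)))
    (hU : ∀ a b, a + b = N → ∀ v ∈ A a, ∀ w ∈ B b, outer N v w ∈ U) :
    ∑ x ∈ antidiagonal N, Module.finrank ℚ (A x.1) * Module.finrank ℚ (B x.2) ≤
      Module.finrank ℚ U := by
  have hadd (x : antidiagonal N) : x.1.1 + x.1.2 = N :=
    Finset.HasAntidiagonal.mem_antidiagonal.1 x.2
  let bA a := Module.finBasis ℚ (A a)
  let bB b := Module.finBasis ℚ (B b)
  let u (i : Σ x : antidiagonal N,
      Fin (Module.finrank ℚ (A x.1.1)) × Fin (Module.finrank ℚ (B x.1.2))) : U :=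
    ⟨outer N (bA i.1.1.1 i.2.1).1 (bB i.1.1.2 i.2.2).1,
      hU _ _ (hadd i.1) _ (Subtype.prop _) _ (Subtype.prop _)⟩
  have hindep : LinearIndependent ℚ u := by
    refine linearIndependent_sigma_of_map
      (fun x => LinearMap.funLeft ℚ ℚ (concat (hadd x)) ∘ₗ U.subtype) ?_ fun x => ?_
    · intro x y hxy k
      refine outer_comp_concat_of_ne (hadd x) (fun h => hxy (Subtype.ext (Prod.ext h ?_))) _ _
      have := hadd x
      have := hadd y
      omega
    · have hmul := linearIndependent_mul
        ((bA x.1.1).linearIndependent.map' (A x.1.1).subtype (Submodule.ker_subtype _))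
        ((bB x.1.2).linearIndependent.map' (B x.1.2).subtype (Submodule.ker_subtype _))
      have hconcat : (fun k => (LinearMap.funLeft ℚ ℚ (concat (hadd x)) ∘ₗ U.subtype) (u ⟨x, k⟩)) =
          fun k y => (bA x.1.1 k.1).1 y.1 * (bB x.1.2 k.2).1 y.2 :=
        funext fun k => outer_comp_concat (hadd x) _ _
      rwa [hconcat]
  have hcard := hindep.fintype_card_le_finrank
  simp only [Fintype.card_sigma, Fintype.card_prod, Fintype.card_fin] at hcard
  rwa [Finset.sum_coe_sort (antidiagonal N)
    fun x => Module.finrank ℚ (A x.1) * Module.finrank ℚ (B x.2)] at hcard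

end Outer

/-! ### Kernels in consecutive depths -/

section Kernels

variable {N a b p q s : ℕ}

theorem Ej_self (N r : ℕ) : Ej N r r le_rfl = E N r := by
  have hlast (m : Fin r → ℕ) : lastEntries r le_rfl m = m :=
    funext fun k => congrArg m (Fin.ext (by simp only [Nat.sub_self, zero_add]))
  ext m n
  simp only [Ej, E, Matrix.of_apply, hlast, Nat.sub_self, Nat.not_lt_zero, IsEmpty.forall_iff,
    implies_true, if_true, one_mul]

/-- The product `E^{(2)} ⋯ E^{(k+1)}` of the first `k` factors of `C`. -/
noncomputable def prodEj (N r k : ℕ) (hk : k < r) : Matrix (S N r) (S N r) ℚ :=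
  (List.ofFn fun i : Fin k => Ej N r (i.val + 2) (by omega)).prod

theorem prodEj_zero (N r : ℕ) (hr : 0 < r) : prodEj N r 0 hr = 1 := by
  rw [prodEj, List.ofFn_zero, List.prod_nil]

theorem prodEj_succ (N r k : ℕ) (hk : k + 1 < r) :
    prodEj N r (k + 1) hk = prodEj N r k (Nat.lt_of_succ_lt hk) * Ej N r (k + 2) hk := by
  rw [prodEj, List.ofFn_succ', List.concat_eq_append, List.prod_append, List.prod_singleton]
  rfl

theorem C_eq_prodEj_mul_E (N s : ℕ) :
    C N (s + 2) = prodEj N (s + 2) s (Nat.lt_add_of_pos_right two_pos) * E N (s + 2) :=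
  rfl

theorem E_one (N : ℕ) : E N 1 = 1 := by
  refine Matrix.ext_of_single_vecMul fun m => funext fun n => ?_
  rw [vecMul_E, iharaOp_apply, iharaSum, Fin.sum_univ_zero, add_zero, coeff_toPoly,
    Matrix.vecMul_one]

theorem C_succ (N s : ℕ) : C N (s + 1) = prodEj N (s + 1) s (Nat.lt_succ_self s) := by
  cases s with
  | zero => rw [prodEj_zero, C, E_one, mul_one, List.ofFn_zero, List.prod_nil]
  | succ s =>
    rw [prodEj_succ, Ej_self]
    rfl

theorem vecMul_outer_prodEj (h : a + b = N) (v : Vect a p) (w : Vect b q) {k : ℕ} (hk : k < q)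
    (hk' : k < p + q) :
    Matrix.vecMul (outer N v w) (prodEj N (p + q) k hk') =
      outer N v (Matrix.vecMul w (prodEj b q k hk)) := by
  induction k with
  | zero => simp only [prodEj_zero, Matrix.vecMul_one]
  | succ k ih =>
    rw [prodEj_succ, prodEj_succ, ← Matrix.vecMul_vecMul, ← Matrix.vecMul_vecMul,
      ih (Nat.lt_of_succ_lt hk), vecMul_outer_Ej h _ _ hk]

theorem vecMul_outer_prodEj_eq_outer_C (h : a + b = N) (v : Vect a p) (w : Vect b (s + 1))
    (hs : s < p + (s + 1)) :
    Matrix.vecMul (outer N v w) (prodEj N (p + (s + 1)) s hs) =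
      outer N v (Matrix.vecMul w (C b (s + 1))) := by
  rw [C_succ, vecMul_outer_prodEj h v w (Nat.lt_succ_self s)]

theorem outer_zero (N : ℕ) (v : Vect a p) : outer N v (0 : Vect b q) = 0 := by
  funext n
  simp only [outer, extendZero, Pi.zero_apply, dite_eq_ite, ite_self, mul_zero]

theorem finrank_comap_of_le_range {K M M' : Type*} [DivisionRing K] [AddCommGroup M] [Module K M]
    [AddCommGroup M'] [Module K M'] [FiniteDimensional K M] (f : M →ₗ[K] M') {D : Submodule K M'}
    (hD : D ≤ LinearMap.range f) :
    Module.finrank K (D.comap f) =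
      Module.finrank K D + Module.finrank K (LinearMap.ker f) := by
  have h := LinearMap.finrank_range_add_finrank_ker (f.domRestrict (D.comap f))
  rwa [LinearMap.range_domRestrict, Submodule.map_comap_eq_of_le hD, LinearMap.ker_domRestrict,
    (Submodule.comapSubtypeEquivOfLe (LinearMap.ker_le_comap f)).finrank_eq, eq_comm] at h

theorem finrank_range_vecMulLinear {ι R : Type*} [Field R] [Fintype ι] (M : Matrix ι ι R) :
    Module.finrank R (LinearMap.range M.vecMulLinear) = M.rank := by
  rw [← Matrix.mulVecLin_transpose, ← Matrix.rank_transpose]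
  rfl

/-- The dimension of the space of right annihilators of `C N r`. -/
noncomputable def kerDim (N r : ℕ) : ℕ := Module.finrank ℚ (LinearMap.ker (C N r).mulVecLin)

theorem rank_add_kerDim (N r : ℕ) : (C N r).rank + kerDim N r = (S N r).card := by
  rw [Matrix.rank, kerDim, LinearMap.finrank_range_add_finrank_ker,
    Module.finrank_fintype_fun_eq_card, Fintype.card_coe]

theorem finrank_ker_vecMulLinear_C (N r : ℕ) :
    Module.finrank ℚ (LinearMap.ker (C N r).vecMulLinear) = kerDim N r := by
  have h := LinearMap.finrank_range_add_finrank_ker (C N r).vecMulLinear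
  rw [finrank_range_vecMulLinear, Module.finrank_fintype_fun_eq_card, Fintype.card_coe,
    ← rank_add_kerDim] at h
  exact Nat.add_left_cancel h

theorem rank_C_one (N : ℕ) : (C N 1).rank = (S N 1).card := by
  rw [C_succ, prodEj_zero, Matrix.rank_one, Fintype.card_coe]

theorem finrank_top_vect (a p : ℕ) :
    Module.finrank ℚ (⊤ : Submodule ℚ (Vect a p)) = (S a p).card := by
  rw [finrank_top, Module.finrank_fintype_fun_eq_card, Fintype.card_coe]

theorem finrank_vecW_le_kerDim_two (N : ℕ) :
    Module.finrank ℚ (vecW N 2 le_rfl) ≤ kerDim N 2 := by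
  rw [← finrank_ker_vecMulLinear_C]
  refine Submodule.finrank_mono fun v hv => funext fun n => ?_
  have h := iharaOp_add_tailIharaOp (s := 0) hv
  rw [tailIharaOp_apply, iharaSum, Fin.sum_univ_zero, add_zero, add_eq_right] at h
  rw [Matrix.vecMulLinear_apply, C_eq_prodEj_mul_E, prodEj_zero, one_mul, vecMul_E, h,
    MvPolynomial.coeff_zero, Pi.zero_apply]

theorem sum_card_mul_kerDim_le {r : ℕ} (hr : 1 + (s + 1) = r) (hs : s < r) :
    ∑ x ∈ antidiagonal N, (S x.1 1).card * kerDim x.2 (s + 1) ≤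
      Module.finrank ℚ (LinearMap.ker (prodEj N r s hs).vecMulLinear) := by
  subst hr
  simp only [← finrank_top_vect, ← finrank_ker_vecMulLinear_C]
  refine sum_finrank_mul_le (fun _ => ⊤) (fun b => LinearMap.ker (C b (s + 1)).vecMulLinear) _
    fun a b h v _ w hw => ?_
  rw [LinearMap.mem_ker, Matrix.vecMulLinear_apply] at hw ⊢
  rw [vecMul_outer_prodEj_eq_outer_C h, hw, outer_zero]

theorem sum_finrank_mul_rank_le {r : ℕ} (hr : 2 + (s + 1) = r) (hs : s < r) (hr₂ : 2 ≤ r) :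
    ∑ x ∈ antidiagonal N, Module.finrank ℚ (vecW x.1 2 le_rfl) * (C x.2 (s + 1)).rank ≤
      Module.finrank ℚ
        ↥(vecW N r hr₂ ⊓ LinearMap.range (prodEj N r s hs).vecMulLinear) := by
  subst hr
  simp only [← finrank_range_vecMulLinear]
  refine sum_finrank_mul_le (fun a => vecW a 2 le_rfl)
    (fun b => LinearMap.range (C b (s + 1)).vecMulLinear) _ fun a b h v hv w hw =>
      ⟨outer_mem_vecW h hv w, ?_⟩
  obtain ⟨u, rfl⟩ := hw
  exact ⟨outer N v u, vecMul_outer_prodEj_eq_outer_C h v u hs⟩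

/-- On `vecW` the matrix `F` acts as the negative of the last factor of `prodEj N (s + 3) (s + 1)`
and its image is annihilated by `E`, so `F` maps the left-hand side injectively into the part of the
left kernel of `C` that is not already annihilated by `prodEj`. -/
theorem finrank_inf_add_finrank_ker_le (hr : 2 ≤ s + 3)
    (hinj : Function.Injective (tasakaMap N (s + 3) hr)) :
    Module.finrank ℚ ↥(vecW N (s + 3) hr ⊓
        LinearMap.range (prodEj N (s + 3) s (by omega)).vecMulLinear) +
      Module.finrank ℚ (LinearMap.ker (prodEj N (s + 3) (s + 1) (by omega)).vecMulLinear) ≤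
      kerDim N (s + 3) := by
  set X := vecW N (s + 3) hr ⊓
    LinearMap.range (prodEj N (s + 3) s (by omega)).vecMulLinear
  set G := (prodEj N (s + 3) (s + 1) (by omega)).vecMulLinear with hG
  have hF : Function.Injective ((F N (s + 3)).vecMulLinear.domRestrict X) := by
    rw [← LinearMap.ker_eq_bot, LinearMap.ker_eq_bot']
    exact fun v hv => Subtype.ext (eq_zero_of_vecMul_F hinj v.2.1 hv)
  have hrange : LinearMap.range ((F N (s + 3)).vecMulLinear.domRestrict X) ≤
      LinearMap.range G := by
    rintro _ ⟨⟨v, hv, u, rfl⟩, rfl⟩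
    rw [LinearMap.domRestrict_apply, Matrix.vecMulLinear_apply, vecMul_F_eq_neg hv]
    refine neg_mem ⟨u, ?_⟩
    rw [hG, Matrix.vecMulLinear_apply, Matrix.vecMulLinear_apply, prodEj_succ,
      Matrix.vecMul_vecMul]
  have hker : (LinearMap.range ((F N (s + 3)).vecMulLinear.domRestrict X)).comap G ≤
      LinearMap.ker (C N (s + 3)).vecMulLinear := by
    rintro u ⟨v, hv⟩
    rw [LinearMap.mem_ker, C_eq_prodEj_mul_E, Matrix.vecMulLinear_apply, ← Matrix.vecMul_vecMul]
    change Matrix.vecMul (G u) _ = 0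
    rw [← hv]
    exact vecMul_F_vecMul_E v.2.1
  rw [← LinearMap.finrank_range_of_inj hF, ← finrank_comap_of_le_range G hrange,
    ← finrank_ker_vecMulLinear_C]
  exact Submodule.finrank_mono hker

theorem sum_add_sum_le_kerDim (hr : 2 ≤ s + 3)
    (hinj : Function.Injective (tasakaMap N (s + 3) hr)) :
    ∑ x ∈ antidiagonal N, (S x.1 1).card * kerDim x.2 (s + 2) +
      ∑ x ∈ antidiagonal N, Module.finrank ℚ (vecW x.1 2 le_rfl) * (C x.2 (s + 1)).rank ≤
      kerDim N (s + 3) := by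
  rw [add_comm]
  exact (add_le_add (sum_finrank_mul_rank_le (by omega) _ _)
    (sum_card_mul_kerDim_le (by omega) _)).trans (finrank_inf_add_finrank_ker_le hr hinj)

theorem tasakaMap_injective_of_pos {r : ℕ} (hr : 2 ≤ r)
    (hinj : ∀ N, 0 < N → Function.Injective (tasakaMap N r hr)) (N : ℕ) :
    Function.Injective (tasakaMap N r hr) := by
  rcases Nat.eq_zero_or_pos N with rfl | hN
  · have hS : IsEmpty (S 0 r) := ⟨fun n => by
      have := three_le_entry n ⟨0, by omega⟩
      have := Finset.sum_eq_zero_iff.1 (mem_S.1 n.2).1 ⟨0, by omega⟩ (Finset.mem_univ _)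
      omega⟩
    have hV : Subsingleton (V 0 r) := by
      rw [V, Set.range_eq_empty, Submodule.span_empty]
      infer_instance
    exact Function.injective_of_subsingleton _
  · exact hinj N hN

end Kernels

/-! ### Generating series -/

section Series

/-- The generating series of a sequence of natural numbers. -/
noncomputable def genSeries (u : ℕ → ℕ) : PowerSeries ℚ := PowerSeries.mk fun n => (u n : ℚ)

theorem coeff_genSeries (u : ℕ → ℕ) (n : ℕ) : PowerSeries.coeff n (genSeries u) = u n :=
  PowerSeries.coeff_mk _ _

theorem coeff_genSeries_mul (u v : ℕ → ℕ) (n : ℕ) :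
    PowerSeries.coeff n (genSeries u * genSeries v) =
      ((∑ x ∈ antidiagonal n, u x.1 * v x.2 : ℕ) : ℚ) := by
  simp only [PowerSeries.coeff_mul, coeff_genSeries, Nat.cast_sum, Nat.cast_mul]

theorem card_S_one (n : ℕ) : (S n 1).card = if 3 ≤ n ∧ Odd n then 1 else 0 := by
  rw [S, Finset.Nat.antidiagonalTuple_one, Finset.filter_singleton, apply_ite Finset.card]
  simp only [Fin.forall_fin_one, Matrix.cons_val_fin_one, Finset.card_singleton, Finset.card_empty]

theorem card_S_two (n : ℕ) :
    (S n 2).card = ∑ x ∈ antidiagonal n, (S x.1 1).card * (S x.2 1).card := by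
  rw [S, Finset.Nat.antidiagonalTuple_two, Finset.filter_map, Finset.card_map, Finset.card_filter]
  refine Finset.sum_congr rfl fun x _ => ?_
  rw [card_S_one, card_S_one, ite_zero_mul_ite_zero, mul_one]
  simp [Fin.forall_fin_two]

theorem oddSeries_eq : oddSeries = genSeries fun n => (S n 1).card := by
  symm
  rw [oddSeries, PowerSeries.eq_mul_inv_iff_mul_eq (by simp)]
  ext n
  rw [mul_sub, mul_one, map_sub, PowerSeries.coeff_mul_X_pow', coeff_genSeries, coeff_genSeries,
    PowerSeries.coeff_X_pow, sub_eq_iff_eq_add, card_S_one, card_S_one]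
  simp only [Nat.odd_iff]
  split_ifs <;> first | omega | norm_num

theorem oddSeries_sq : oddSeries ^ 2 = genSeries fun n => (S n 2).card := by
  ext n
  rw [sq, oddSeries_eq, coeff_genSeries_mul, coeff_genSeries, card_S_two]

/-- The dimension of the space of cusp forms of weight `n` and level one, written as the number of
antisymmetric pairs of exponents minus the number of conditions in `eq_zero_of_dihedral`. -/
def cuspDim (n : ℕ) : ℕ := if Even n then (n / 2 - 2) / 2 - (n - 2) / 6 else 0

theorem cuspDim_of_odd {n : ℕ} (hn : Odd n) : cuspDim n = 0 :=
  if_neg (Nat.not_even_iff_odd.2 hn)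

theorem cuspDim_two_mul (m : ℕ) : cuspDim (2 * m) = (m - 2) / 2 - (m - 1) / 3 := by
  rw [cuspDim, if_pos (even_two_mul m)]
  omega

theorem cuspDim_add_ten {n : ℕ} (hn : n ≠ 2) :
    cuspDim (n + 10) + cuspDim n = cuspDim (n + 6) + cuspDim (n + 4) := by
  obtain ⟨m, rfl | rfl⟩ := Nat.even_or_odd' n
  · rw [show 2 * m + 10 = 2 * (m + 5) by ring, show 2 * m + 6 = 2 * (m + 3) by ring,
      show 2 * m + 4 = 2 * (m + 2) by ring]
    simp only [cuspDim_two_mul]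
    omega
  · have hodd (j : ℕ) : cuspDim (2 * m + 1 + 2 * j) = 0 := cuspDim_of_odd ⟨m + j, by ring⟩
    rw [hodd 0, hodd 2, hodd 3, hodd 5]

theorem cuspSeries_eq : cuspSeries = genSeries cuspDim := by
  symm
  rw [cuspSeries, PowerSeries.eq_mul_inv_iff_mul_eq (by simp)]
  have hexpand (p : PowerSeries ℚ) :
      p * ((1 - PowerSeries.X ^ 4) * (1 - PowerSeries.X ^ 6)) =
        p + p * PowerSeries.X ^ 10 - (p * PowerSeries.X ^ 4 + p * PowerSeries.X ^ 6) := by ring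
  ext n
  rw [hexpand, map_sub, map_add, map_add, sub_eq_iff_eq_add]
  simp only [PowerSeries.coeff_mul_X_pow', PowerSeries.coeff_X_pow, coeff_genSeries]
  rcases lt_or_ge n 13 with hn | hn
  · interval_cases n <;> simp [cuspDim, Nat.even_iff]
  · obtain ⟨n, rfl⟩ := Nat.exists_eq_add_of_le' (show 10 ≤ n by omega)
    simp only [show n + 10 ≠ 12 by omega, show 4 ≤ n + 10 by omega, show 6 ≤ n + 10 by omega,
      show 10 ≤ n + 10 by omega, if_true, if_false, Nat.add_sub_cancel,
      show n + 10 - 4 = n + 6 by omega, show n + 10 - 6 = n + 4 by omega]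
    exact_mod_cast (cuspDim_add_ten (by omega)).trans (zero_add _).symm

theorem cuspDim_le_finrank_vecW (N : ℕ) :
    cuspDim N ≤ Module.finrank ℚ (vecW N 2 le_rfl) := by
  rw [cuspDim]
  split_ifs with h
  · exact le_finrank_vecW h
  · exact Nat.zero_le _

/-- The power series with nonnegative coefficients; coefficientwise inequalities between power
series are expressed as membership of differences. -/
def nonnegSeries (R : Type*) [Semiring R] [PartialOrder R] [IsOrderedRing R] :
    Subsemiring (PowerSeries R) where
  carrier := {φ | ∀ n, 0 ≤ PowerSeries.coeff n φ}
  zero_mem' n := (map_zero (PowerSeries.coeff n)).ge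
  one_mem' n := by
    rw [PowerSeries.coeff_one]
    split_ifs
    exacts [zero_le_one, le_rfl]
  add_mem' hφ hψ n := by
    rw [map_add]
    exact add_nonneg (hφ n) (hψ n)
  mul_mem' hφ hψ n := by
    rw [PowerSeries.coeff_mul]
    exact Finset.sum_nonneg fun x _ => mul_nonneg (hφ _) (hψ _)

theorem genSeries_mem_nonnegSeries (u : ℕ → ℕ) : genSeries u ∈ nonnegSeries ℚ := fun n => by
  rw [coeff_genSeries]
  exact Nat.cast_nonneg _

theorem genSeries_sub_mem_nonnegSeries {u v : ℕ → ℕ} (h : ∀ n, u n ≤ v n) :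
    genSeries v - genSeries u ∈ nonnegSeries ℚ := fun n => by
  rw [map_sub, coeff_genSeries, coeff_genSeries, sub_nonneg]
  exact_mod_cast h n

/-- Eliminates the depth two and three kernels `K₂`, `K₃` from the two recursive lower bounds, where
`O ^ 2 - K₂` is the rank in depth two. -/
theorem sub_mem_of_recursion {R : Type*} [CommRing R] (P : Subsemiring R) {O W S K₂ K₃ K₄ : R}
    (hO : O ∈ P) (hOW : O ^ 2 - W ∈ P) (hWS : W - S ∈ P) (hK₂ : K₂ - W ∈ P)
    (hK₃ : K₃ - (O * K₂ + W * O) ∈ P) (hK₄ : K₄ - (O * K₃ + W * (O ^ 2 - K₂)) ∈ P) :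
    K₄ - (3 * O ^ 2 * S - S ^ 2) ∈ P := by
  have h : K₄ - (3 * O ^ 2 * S - S ^ 2) =
      (K₄ - (O * K₃ + W * (O ^ 2 - K₂))) + O * (K₃ - (O * K₂ + W * O)) +
        (K₂ - W) * (O ^ 2 - W) +
        (W - S) * (O ^ 2 + (O ^ 2 - W) + (O ^ 2 - W) + (W - S)) := by ring
  rw [h]
  exact add_mem (add_mem (add_mem hK₄ (mul_mem hO hK₃)) (mul_mem hK₂ hOW))
    (mul_mem hWS (add_mem (add_mem (add_mem (pow_mem hO 2) hOW) hOW) hWS))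

end Series

section Recursion

/-- The generating series of the dimensions of `W_{N,2}`. -/
noncomputable def periodSeries : PowerSeries ℚ :=
  genSeries fun n => Module.finrank ℚ (vecW n 2 le_rfl)

/-- The generating series in `N` of the dimensions of the right kernels of `C_{N,r}`. -/
noncomputable def kerSeries (r : ℕ) : PowerSeries ℚ := genSeries fun n => kerDim n r

theorem genSeries_rank_C_one : (genSeries fun n => (C n 1).rank) = oddSeries := by
  simp only [oddSeries_eq, rank_C_one]

theorem genSeries_rank_C_two : (genSeries fun n => (C n 2).rank) = oddSeries ^ 2 - kerSeries 2 := by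
  ext n
  rw [oddSeries_sq, kerSeries, map_sub, coeff_genSeries, coeff_genSeries, coeff_genSeries,
    ← rank_add_kerDim, Nat.cast_add, add_sub_cancel_right]

theorem oddSeries_sq_sub_periodSeries_mem : oddSeries ^ 2 - periodSeries ∈ nonnegSeries ℚ := by
  rw [oddSeries_sq]
  refine genSeries_sub_mem_nonnegSeries fun n => ?_
  rw [← finrank_top_vect]
  exact Submodule.finrank_mono le_top

theorem kerSeries_sub_mem {s : ℕ} (hr : 2 ≤ s + 3)
    (hinj : ∀ N, 0 < N → Function.Injective (tasakaMap N (s + 3) hr)) :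
    kerSeries (s + 3) - (oddSeries * kerSeries (s + 2) +
      periodSeries * genSeries fun n => (C n (s + 1)).rank) ∈ nonnegSeries ℚ := fun n => by
  rw [oddSeries_eq, kerSeries, kerSeries, periodSeries, map_sub, map_add, coeff_genSeries_mul,
    coeff_genSeries_mul, coeff_genSeries, sub_nonneg]
  exact_mod_cast sum_add_sum_le_kerDim hr (tasakaMap_injective_of_pos hr hinj n)

end Recursion

end TotallyOdd

theorem mainTheorem2_general
    (hinj₃ : ∀ N, 0 < N → Function.Injective (TotallyOdd.tasakaMap N 3 (by decide)))
    (hinj₄ : ∀ N, 0 < N → Function.Injective (TotallyOdd.tasakaMap N 4 (by decide))) (N : ℕ) :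
    PowerSeries.coeff N
        (3 * TotallyOdd.oddSeries ^ 2 * TotallyOdd.cuspSeries - TotallyOdd.cuspSeries ^ 2) ≤
      (Module.finrank ℚ (LinearMap.ker (TotallyOdd.C N 4).mulVecLin) : ℚ) := by
  open TotallyOdd in
  have hodd : oddSeries ∈ nonnegSeries ℚ := oddSeries_eq ▸ genSeries_mem_nonnegSeries _
  have hcusp : periodSeries - cuspSeries ∈ nonnegSeries ℚ :=
    cuspSeries_eq ▸ genSeries_sub_mem_nonnegSeries cuspDim_le_finrank_vecW
  have hker₂ : kerSeries 2 - periodSeries ∈ nonnegSeries ℚ :=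
    genSeries_sub_mem_nonnegSeries finrank_vecW_le_kerDim_two
  have hker₃ : kerSeries 3 - (oddSeries * kerSeries 2 + periodSeries * oddSeries) ∈
      nonnegSeries ℚ := genSeries_rank_C_one ▸ kerSeries_sub_mem (s := 0) _ hinj₃
  have hker₄ : kerSeries 4 - (oddSeries * kerSeries 3 +
      periodSeries * (oddSeries ^ 2 - kerSeries 2)) ∈ nonnegSeries ℚ :=
    genSeries_rank_C_two ▸ kerSeries_sub_mem (s := 1) _ hinj₄
  have h := sub_mem_of_recursion (nonnegSeries ℚ) hodd oddSeries_sq_sub_periodSeries_mem hcusp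
    hker₂ hker₃ hker₄ N
  rwa [map_sub, kerSeries, coeff_genSeries, sub_nonneg] at h

theorem mainTheorem2
    (hinj : ∀ (N r : ℕ) (hr : 2 ≤ r), 0 < N →
      Function.Injective (TotallyOdd.tasakaMap N r hr))
    (N : ℕ) (hN : 0 < N) :
    PowerSeries.coeff N
        (3 * TotallyOdd.oddSeries ^ 2 * TotallyOdd.cuspSeries - TotallyOdd.cuspSeries ^ 2) ≤
      (Module.finrank ℚ (LinearMap.ker (TotallyOdd.C N 4).mulVecLin) : ℚ) :=
  mainTheorem2_general (fun N => hinj N 3 _) (fun N => hinj N 4 _) N
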